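/- **Setting.** Let $\boldsymbol x_1,\dots,\boldsymbol x_n\in\mathbb R^d$, $\boldsymbol y\in\mathbb R^n$, $\rho>0$, and $\Omega=\{(i,j):1\le i,j\le n,\ i\ne j\}$. Let $\boldsymbol A\in\mathbb R^{n(n-1)\times n}$ and $\boldsymbol B\in\mathbb R^{n(n-1)\times nd}$ be the matrices for which the row $(i,j)\in\Omega$ of $\boldsymbol A\boldsymbol\phi+\boldsymbol B\boldsymbol\xi$ is $\phi_j-\phi_i-\langle \boldsymbol x_j-\boldsymbol x_i,\boldsymbol\xi_i\rangle$. Consider $$L^\star=\min_{\boldsymbol\lambda\in\mathbb R^{\Omega},\ \boldsymbol\lambda\le 0}L(\boldsymbol\lambda),\qquad L(\boldsymbol\lambda)=\tfrac1{2\rho}\boldsymbol\lambda^\top(\rho\boldsymbol A\boldsymbol A^\top+\boldsymbol B\boldsymbol B^\top)\boldsymbol\lambda-\boldsymbol y^\top\boldsymbol A^\top\boldsymbol\lambda. \tag{D}$$ Let $\sigma$ be the largest eigenvalue of $\boldsymbol Q=\boldsymbol A\boldsymbol A^\top+\frac1\rho\boldsymbol B\boldsymbol B^\top$ (the smoothness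 constant of $L$), and for $W\subseteq\Omega$ let $\sigma_W\le\sigma$ be the largest eigenvalue of the principal submatrix of $\boldsymbol Q$ on $W$. The reduced dual $(D_W)$ is the minimization of $L$ over $\boldsymbol\lambda\le 0$ with $\lambda_\omega=0$ for all $\omega\notin W$. **Algorithm 1.** Start with $W^0\subseteq\Omega$ and a feasible point $\boldsymbol\lambda^0$ of $(D_{W^0})$; optionally, replace $\boldsymbol\lambda^0$ first by the result of a solve of $(D_{W^0})$ as in step 2. For $m=0,1,2,\dots$: 1. Compute $\boldsymbol\phi=\boldsymbol y-\boldsymbol A^\top\boldsymbol\lambda^m$, $\boldsymbol\xi=-\frac1\rho\boldsymbol B^\top\boldsymbol\lambda^m$ and $\boldsymbol v=\boldsymbol A\boldsymbol\phi+\boldsymbol B\boldsymbol\xi$. Select a set $\Delta'\subseteq\Omega\setminus W^m$ by a fixed rule (below) and put $W^{m+1}=W^m\cup\{\omega\in\Delta':v_\omega<0\}$. 2. Let $\boldsymbol\lambda^{m+1}$ be either an optimal solution of $(D_{W^{m+1}})$ (method EAS), or the result of one or more proximal (projected) gradient steps for $(D_{W^{m+1}})$ with step sizes in $[1/\sigma,1/\sigma_{W^{m+1}}]$,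 starting from $\boldsymbol\lambda^m$ (method ASGD). **Rules.** Let $\Omega_1,\dots,\Omega_n$ be the blocks of $\Omega$ with fixed first index, or those with fixed second index. Random sets are drawn, given the past, uniformly among the subsets of the stated size; if a set has fewer elements than are to be chosen, all are chosen. - Rule 1: in each $\Omega_i\setminus W^m$, the $P$ indices with the smallest $v$. - Rule 2: $K$ random indices of $\Omega\setminus W^m$. - Rule 3: $P$ random indices of each $\Omega_i\setminus W^m$. - Rule 4: of $M$ random indices of $\Omega\setminus W^m$, the $K$ with the smallest $v$. - Rule 5: for $G$ random blocks $\Omega_i$, in each $\Omega_i\setminus W^m$ the $P$ indices with the smallest $v$. Here $1\le P\le n-1$, $1\le G\le n$, $1\le K\le n(n-1)$, and $K\le M\le n(n-1)$ in Rule 4. Ties are broken arbitrarily. For $\boldsymbol\theta\in\mathbb R^\Omega$ let $\|\boldsymbol\theta\|_{\{\ell\}}^2$ be the expectation of $\sum_\omega\theta_\omega^2$ over the indices selected by Rule $\ell$ when the active set is empty and $v_\omega=-|\theta_\omega|$. Put $$\alpha_{\{1\}}=\alpha_{\{3\}}=\tfrac{n-1}{P},\qquad \alpha_{\{2\}}=\alpha_{\{4\}}=\tfrac{n(n-1)}{K},\qquad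 \alpha_{\{5\}}=\tfrac{n(n-1)}{GP}.$$ **Hoffman constant.** A number $\mu>0$ is a Hoffman constant of a matrix $\boldsymbol D$ if for every nonempty $\Lambda=\{\boldsymbol\lambda:\boldsymbol D\boldsymbol\lambda=\boldsymbol s,\ \boldsymbol\lambda\le0\}$ and every $\boldsymbol\lambda\le 0$ there is $\boldsymbol\lambda_0\in\Lambda$ with $\|\boldsymbol D\boldsymbol\lambda-\boldsymbol s\|^2\ge\mu\|\boldsymbol\lambda-\boldsymbol\lambda_0\|^2$. **Theorem.** The matrix $\boldsymbol D^\star=\begin{bmatrix}\boldsymbol A^\top\\ \boldsymbol B^\top/\sqrt\rho\end{bmatrix}$, which depends only on $\boldsymbol A,\boldsymbol B,\rho$, has a Hoffman constant. Let $\mu$ be any Hoffman constant of $\boldsymbol D^\star$. Then for each of the Rules $\ell=1,\dots,5$ one has $\|\boldsymbol\theta\|^2\le\alpha_{\{\ell\}}\|\boldsymbol\theta\|_{\{\ell\}}^2$ for all $\boldsymbol\theta\in\mathbb R^\Omega$ and $0\le 1-\frac{\mu}{\sigma\alpha_{\{\ell\}}}<1$, and for EAS as well as for ASGD, for all $\boldsymbol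 y$, $W^0$, $\boldsymbol\lambda^0$ as above and all $m\ge0$, $$\mathbb E\left[L(\boldsymbol\lambda^m)-L^\star\right]\le\left(1-\frac{\mu}{\sigma\,\alpha_{\{\ell\}}}\right)^m\left[L(\boldsymbol\lambda^0)-L^\star\right],$$ where on the right $\boldsymbol\lambda^0$ is the given starting point. -/

import Mathlib

open MeasureTheory Finset
open scoped Matrix

namespace ConvexRegression

noncomputable section

/-- The index set `Ω = {(i, j) : i ≠ j}` of the constraints. -/
abbrev Pair (n : ℕ) : Type := {p : Fin n × Fin n // p.1 ≠ p.2}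

/-! ### The dual problem -/

/-- Row `(i, j)` of `A φ` is `φ_j - φ_i`. -/
def matA (n : ℕ) : Matrix (Pair n) (Fin n) ℝ :=
  fun p k => (if k = p.1.2 then 1 else 0) - (if k = p.1.1 then 1 else 0)

/-- Row `(i, j)` of `B ξ` is `-⟨x_j - x_i, ξ_i⟩`. -/
def matB {n d : ℕ} (x : Fin n → EuclideanSpace ℝ (Fin d)) :
    Matrix (Pair n) (Fin n × Fin d) ℝ :=
  fun p k => if k.1 = p.1.1 then -(x p.1.2 k.2 - x p.1.1 k.2) else 0

/-- The dual objective
`L(λ) = (1 / (2ρ)) λᵀ (ρ A Aᵀ + B Bᵀ) λ - yᵀ Aᵀ λ`. -/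
def dualObj {n d : ℕ} (x : Fin n → EuclideanSpace ℝ (Fin d)) (ρ : ℝ) (y : Fin n → ℝ)
    (lam : Pair n → ℝ) : ℝ :=
  1 / (2 * ρ) * (lam ⬝ᵥ ((ρ • (matA n * (matA n)ᵀ) + matB x * (matB x)ᵀ) *ᵥ lam))
    - y ⬝ᵥ ((matA n)ᵀ *ᵥ lam)

/-- The optimal value `L*` of the dual problem `min L(λ)` subject to `λ ≤ 0`. -/
def dualOpt {n d : ℕ} (x : Fin n → EuclideanSpace ℝ (Fin d)) (ρ : ℝ) (y : Fin n → ℝ) : ℝ :=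
  sInf (dualObj x ρ y '' {lam | ∀ p, lam p ≤ 0})

/-- The Hessian `Q = A Aᵀ + (1 / ρ) B Bᵀ` of `L`. -/
def matQ {n d : ℕ} (x : Fin n → EuclideanSpace ℝ (Fin d)) (ρ : ℝ) :
    Matrix (Pair n) (Pair n) ℝ :=
  matA n * (matA n)ᵀ + (1 / ρ) • (matB x * (matB x)ᵀ)

theorem matQ_isHermitian {n d : ℕ} (x : Fin n → EuclideanSpace ℝ (Fin d)) (ρ : ℝ) :
    (matQ x ρ).IsHermitian := by
  unfold matQ Matrix.IsHermitian
  simp [Matrix.conjTranspose_eq_transpose_of_trivial, Matrix.transpose_add,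
    Matrix.transpose_smul, Matrix.transpose_mul]

/-- The gradient `∇L(λ) = Q λ - A y`. -/
def dualGrad {n d : ℕ} (x : Fin n → EuclideanSpace ℝ (Fin d)) (ρ : ℝ) (y : Fin n → ℝ)
    (lam : Pair n → ℝ) : Pair n → ℝ :=
  matQ x ρ *ᵥ lam - matA n *ᵥ y

/-- The largest eigenvalue of a symmetric matrix (`0` for the empty matrix). -/
def maxEigenvalue {ι : Type} [Fintype ι] [DecidableEq ι] {M : Matrix ι ι ℝ}
    (hM : M.IsHermitian) : ℝ :=
  ⨆ i, hM.eigenvalues i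

/-- The smoothness constant `σ` of `L`, the largest eigenvalue of `Q`. -/
def smoothness {n d : ℕ} (x : Fin n → EuclideanSpace ℝ (Fin d)) (ρ : ℝ) : ℝ :=
  maxEigenvalue (matQ_isHermitian x ρ)

/-- The smoothness constant `σ_W` of the reduced dual objective `L_W`, the largest eigenvalue of
the principal submatrix of `Q` with rows and columns in `W`. -/
def smoothnessOn {n d : ℕ} (x : Fin n → EuclideanSpace ℝ (Fin d)) (ρ : ℝ)
    (W : Finset (Pair n)) : ℝ :=
  maxEigenvalue ((matQ_isHermitian x ρ).submatrix (Subtype.val : W → Pair n))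

/-- The matrix `D*` with the blocks `Aᵀ` and `Bᵀ / √ρ` on top of each other. -/
def matD {n d : ℕ} (x : Fin n → EuclideanSpace ℝ (Fin d)) (ρ : ℝ) :
    Matrix (Fin n ⊕ Fin n × Fin d) (Pair n) ℝ :=
  Matrix.fromRows (matA n)ᵀ ((1 / √ρ) • (matB x)ᵀ)

/-- The squared Euclidean norm. -/
def sqNorm {ι : Type} [Fintype ι] (u : ι → ℝ) : ℝ := ∑ i, u i ^ 2

/-- `μ > 0` is a Hoffman constant of `D`: for every nonempty polyhedron
`Λ = {λ : D λ = s, λ ≤ 0}` and every `λ ≤ 0` there is `λ₀ ∈ Λ` with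
`‖D λ - s‖² ≥ μ ‖λ - λ₀‖²`. -/
def IsHoffmanConstant {ι κ : Type} [Fintype ι] [Fintype κ] (D : Matrix ι κ ℝ) (μ : ℝ) : Prop :=
  0 < μ ∧ ∀ s : ι → ℝ, (∃ z : κ → ℝ, D *ᵥ z = s ∧ ∀ k, z k ≤ 0) →
    ∀ lam : κ → ℝ, (∀ k, lam k ≤ 0) →
      ∃ lam₀ : κ → ℝ, D *ᵥ lam₀ = s ∧ (∀ k, lam₀ k ≤ 0) ∧
        μ * sqNorm (lam - lam₀) ≤ sqNorm (D *ᵥ lam - s)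

/-! ### The reduced dual problem

A vector `λ_W` indexed by `W ⊆ Ω` is represented by its extension by zero to `Ω`. -/

/-- Feasibility for the reduced dual problem on `W`. -/
def ReducedFeasible {n : ℕ} (W : Finset (Pair n)) (lam : Pair n → ℝ) : Prop :=
  (∀ p, lam p ≤ 0) ∧ ∀ p, p ∉ W → lam p = 0

/-- Optimality for the reduced dual problem on `W`. -/
def ReducedOptimal {n d : ℕ} (x : Fin n → EuclideanSpace ℝ (Fin d)) (ρ : ℝ) (y : Fin n → ℝ)
    (W : Finset (Pair n)) (lam : Pair n → ℝ) : Prop :=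
  ReducedFeasible W lam ∧ ∀ z, ReducedFeasible W z → dualObj x ρ y lam ≤ dualObj x ρ y z

/-- One proximal (projected) gradient step with step size `t` for the reduced dual problem
on `W`. -/
def proxStep {n d : ℕ} (x : Fin n → EuclideanSpace ℝ (Fin d)) (ρ : ℝ) (y : Fin n → ℝ)
    (W : Finset (Pair n)) (t : ℝ) (lam : Pair n → ℝ) : Pair n → ℝ :=
  fun p => if p ∈ W then min 0 (lam p - t * dualGrad x ρ y lam p) else 0

/-- `EAS`: the reduced dual problem is solved exactly; `ASGD`: it is solved inexactly, by
proximal gradient steps. -/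
inductive Mode : Type
  | EAS
  | ASGD

/-- `SolveReduced … W lam lam'`: the vector `lam'` is an output of the reduced solve on `W` with
starting point `lam`. In mode `EAS` it is any optimal solution. In mode `ASGD` it arises from
`lam` by one or more proximal gradient steps, each with a step size `t ∈ [1 / σ, 1 / σ_W]`. -/
def SolveReduced {n d : ℕ} (x : Fin n → EuclideanSpace ℝ (Fin d)) (ρ : ℝ) (y : Fin n → ℝ)
    (mode : Mode) (W : Finset (Pair n)) (lam lam' : Pair n → ℝ) : Prop :=
  match mode with
  | Mode.EAS => ReducedOptimal x ρ y W lam'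
  | Mode.ASGD =>
      Relation.TransGen
        (fun z z' => ∃ t : ℝ, 1 ≤ smoothness x ρ * t ∧ smoothnessOn x ρ W * t ≤ 1 ∧
          z' = proxStep x ρ y W t z) lam lam'

/-! ### Augmentation rules -/

/-- The primal vector `φ = y - Aᵀ λ`. -/
def primalPhi {n : ℕ} (y : Fin n → ℝ) (lam : Pair n → ℝ) : Fin n → ℝ :=
  y - (matA n)ᵀ *ᵥ lam

/-- The primal vector `ξ = -(1 / ρ) Bᵀ λ`. -/
def primalXi {n d : ℕ} (x : Fin n → EuclideanSpace ℝ (Fin d)) (ρ : ℝ)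
    (lam : Pair n → ℝ) : Fin n × Fin d → ℝ :=
  -((1 / ρ) • ((matB x)ᵀ *ᵥ lam))

/-- The constraint values `v = A φ + B ξ`; a negative entry is a violated constraint. -/
def violation {n d : ℕ} (x : Fin n → EuclideanSpace ℝ (Fin d)) (ρ : ℝ) (y : Fin n → ℝ)
    (lam : Pair n → ℝ) : Pair n → ℝ :=
  matA n *ᵥ primalPhi y lam + matB x *ᵥ primalXi x ρ lam

/-- The two decompositions of `Ω` into `n` blocks: by the first or by the second index. -/
inductive BlockKind : Type
  | first
  | second

/-- The block `Ω_{i·}` or `Ω_{·i}`. -/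
def block {n : ℕ} (b : BlockKind) (i : Fin n) : Finset (Pair n) :=
  match b with
  | BlockKind.first => univ.filter fun p => p.1.1 = i
  | BlockKind.second => univ.filter fun p => p.1.2 = i

/-- The five augmentation rules with their parameters. -/
inductive Rule : Type
  /-- Rule 1: the `P` smallest values within each block. -/
  | greedyBlock (P : ℕ)
  /-- Rule 2: `K` random indices. -/
  | random (K : ℕ)
  /-- Rule 3: `P` random indices within each block. -/
  | randomBlock (P : ℕ)
  /-- Rule 4: `M` random indices, and of these the `K` smallest values. -/
  | randomGreedy (M K : ℕ)
  /-- Rule 5: `G` random blocks, and in each of these the `P` smallest values. -/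
  | randomBlockGreedy (G P : ℕ)

/-- The parameters are positive and no sample is larger than the set from which it is taken
(when the active set is empty). -/
def Rule.Valid (n : ℕ) : Rule → Prop
  | Rule.greedyBlock P => 1 ≤ P ∧ P ≤ n - 1
  | Rule.random K => 1 ≤ K ∧ K ≤ n * (n - 1)
  | Rule.randomBlock P => 1 ≤ P ∧ P ≤ n - 1
  | Rule.randomGreedy M K => 1 ≤ K ∧ K ≤ M ∧ M ≤ n * (n - 1)
  | Rule.randomBlockGreedy G P => 1 ≤ G ∧ G ≤ n ∧ 1 ≤ P ∧ P ≤ n - 1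

/-- The norm-equivalence constant `α` of a rule. -/
def Rule.alpha (n : ℕ) : Rule → ℝ
  | Rule.greedyBlock P => ((n : ℝ) - 1) / P
  | Rule.random K => (n : ℝ) * ((n : ℝ) - 1) / K
  | Rule.randomBlock P => ((n : ℝ) - 1) / P
  | Rule.randomGreedy _ K => (n : ℝ) * ((n : ℝ) - 1) / K
  | Rule.randomBlockGreedy G P => (n : ℝ) * ((n : ℝ) - 1) / ((G : ℝ) * P)

/-- `T` consists of `k` elements of `S` with the smallest values of `v`, ties being broken
arbitrarily; it is all of `S` if `S` has fewer than `k` elements. -/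
def IsSmallest {ι : Type} [DecidableEq ι] (S : Finset ι) (k : ℕ) (v : ι → ℝ)
    (T : Finset ι) : Prop :=
  T ⊆ S ∧ #T = min k #S ∧ ∀ a ∈ T, ∀ b ∈ S \ T, v a ≤ v b

theorem exists_isSmallest {ι : Type} [DecidableEq ι] (S : Finset ι) (k : ℕ) (v : ι → ℝ) :
    ∃ T, IsSmallest S k v T := by
  induction k with
  | zero => exact ⟨∅, by simp [IsSmallest]⟩
  | succ k ih =>
    obtain ⟨T, hTS, hc, hT⟩ := ih
    by_cases h : (S \ T).Nonempty
    · obtain ⟨a, ha, hmin⟩ := exists_min_image (S \ T) v h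
      have ha' := mem_sdiff.1 ha
      have hlt : #T < #S := by
        have h1 := card_sdiff_add_card_eq_card hTS
        have h2 := h.card_pos
        omega
      refine ⟨insert a T, insert_subset ha'.1 hTS, ?_, ?_⟩
      · rw [card_insert_of_notMem ha'.2]
        omega
      · intro c hcT b hb
        have hb' : b ∈ S \ T := by
          rw [mem_sdiff, mem_insert] at hb
          exact mem_sdiff.2 ⟨hb.1, fun h => hb.2 (Or.inr h)⟩
        rcases mem_insert.1 hcT with rfl | hcT
        · exact hmin b hb'
        · exact hT c hcT b hb'
    · have hST : S = T := by
        rw [not_nonempty_iff_eq_empty, sdiff_eq_empty_iff_subset] at h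
        exact h.antisymm hTS
      subst hST
      refine ⟨S, Subset.rfl, ?_, by simp⟩
      omega

/-- The operator `𝒢[S, k, θ]`: `k` elements of `S` with the largest values of `|θ|`. -/
def largest {ι : Type} [DecidableEq ι] (S : Finset ι) (k : ℕ) (θ : ι → ℝ) : Finset ι :=
  (exists_isSmallest S k fun a => -|θ a|).choose

/-- The square of the norm of a rule: the expectation of the sum of `θ_ω²` over the indices
`ω` that the rule selects for the vector `θ` when the active set is empty. The average
`(S.powersetCard k).expect f` is the expectation of `f` at a uniformly random `k`-element subset
of `S`. -/
def ruleNormSq {n : ℕ} (b : BlockKind) (r : Rule) (θ : Pair n → ℝ) : ℝ :=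
  match r with
  | Rule.greedyBlock P => ∑ p ∈ univ.biUnion fun i => largest (block b i) P θ, θ p ^ 2
  | Rule.random K => (univ.powersetCard K).expect fun U : Finset (Pair n) => ∑ p ∈ U, θ p ^ 2
  | Rule.randomBlock P =>
      ∑ i, ((block b i).powersetCard P).expect fun U => ∑ p ∈ U, θ p ^ 2
  | Rule.randomGreedy M K =>
      (univ.powersetCard M).expect fun U : Finset (Pair n) => ∑ p ∈ largest U K θ, θ p ^ 2
  | Rule.randomBlockGreedy G P =>
      (univ.powersetCard G).expect fun I : Finset (Fin n) =>
        ∑ p ∈ I.biUnion fun i => largest (block b i) P θ, θ p ^ 2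

/-- Conditionally on the history `𝒢`, the random set `U` is a uniformly random `k`-element subset
of `S` (all of `S` if `S` has fewer than `k` elements). -/
def IsUniformSample {Ω : Type*} {mΩ : MeasurableSpace Ω} (P : Measure Ω)
    (𝒢 : MeasurableSpace Ω) {ι : Type} [DecidableEq ι]
    (S : Ω → Finset ι) (k : ℕ) (U : Ω → Finset ι) : Prop :=
  (∀ T, MeasurableSet[mΩ] {ω | U ω = T}) ∧
    ∀ T, P[{ω | U ω = T}.indicator (fun _ => (1 : ℝ)) | 𝒢] =ᵐ[P] fun ω =>
      if T ∈ (S ω).powersetCard (min k #(S ω)) then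
        (#((S ω).powersetCard (min k #(S ω))) : ℝ)⁻¹ else 0

/-- `Δ'` is the random set of candidates that a rule selects, given the history `𝒢`, for the
current active set `W` and the current dual vector `lam`. For the rule `randomBlock` each block
is sampled uniformly; the joint law of the samples of different blocks is left free. -/
def Selects {n d : ℕ} (x : Fin n → EuclideanSpace ℝ (Fin d)) (ρ : ℝ) (y : Fin n → ℝ)
    (b : BlockKind) (r : Rule) {Ω : Type*} {mΩ : MeasurableSpace Ω} (P : Measure Ω)
    (𝒢 : MeasurableSpace Ω) (W : Ω → Finset (Pair n)) (lam : Ω → Pair n → ℝ)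
    (Δ' : Ω → Finset (Pair n)) : Prop :=
  match r with
  | Rule.greedyBlock k =>
      ∀ᵐ ω ∂P, ∃ T : Fin n → Finset (Pair n),
        (∀ i, IsSmallest (block b i \ W ω) k (violation x ρ y (lam ω)) (T i)) ∧
          Δ' ω = univ.biUnion T
  | Rule.random K => IsUniformSample P 𝒢 (fun ω => univ \ W ω) K Δ'
  | Rule.randomBlock k =>
      ∃ U : Fin n → Ω → Finset (Pair n),
        (∀ i, IsUniformSample P 𝒢 (fun ω => block b i \ W ω) k (U i)) ∧
          ∀ᵐ ω ∂P, Δ' ω = univ.biUnion fun i => U i ω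
  | Rule.randomGreedy M K =>
      ∃ U : Ω → Finset (Pair n), IsUniformSample P 𝒢 (fun ω => univ \ W ω) M U ∧
        ∀ᵐ ω ∂P, IsSmallest (U ω) K (violation x ρ y (lam ω)) (Δ' ω)
  | Rule.randomBlockGreedy G k =>
      ∃ I : Ω → Finset (Fin n), IsUniformSample P 𝒢 (fun _ => univ) G I ∧
        ∀ᵐ ω ∂P, ∃ T : Fin n → Finset (Pair n),
          (∀ i ∈ I ω, IsSmallest (block b i \ W ω) k (violation x ρ y (lam ω)) (T i)) ∧
            Δ' ω = (I ω).biUnion T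

/-- The active set `W` is augmented to `W'` by the violated ones among the selected candidates. -/
def Augments {n d : ℕ} (x : Fin n → EuclideanSpace ℝ (Fin d)) (ρ : ℝ) (y : Fin n → ℝ)
    (b : BlockKind) (r : Rule) {Ω : Type*} {mΩ : MeasurableSpace Ω} (P : Measure Ω)
    (𝒢 : MeasurableSpace Ω) (W : Ω → Finset (Pair n)) (lam : Ω → Pair n → ℝ)
    (W' : Ω → Finset (Pair n)) : Prop :=
  ∃ Δ' : Ω → Finset (Pair n), Selects x ρ y b r P 𝒢 W lam Δ' ∧
    ∀ᵐ ω ∂P, W' ω = W ω ∪ (Δ' ω).filter fun p => violation x ρ y (lam ω) p < 0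

/-! ### The algorithm -/

/-- `W m` and `lam m` are the active sets and the dual vectors (extended by zero) of a run of the
active set method started from `W0` and `lam0`; `ℱ m` is the history up to the `m`-th reduced
solve. The first dual vector `lam 0` is the result of a reduced solve on `W0` started at `lam0`,
or `lam0` itself. -/
structure IsRun {n d : ℕ} (x : Fin n → EuclideanSpace ℝ (Fin d)) (ρ : ℝ) (y : Fin n → ℝ)
    (mode : Mode) (b : BlockKind) (r : Rule) (W0 : Finset (Pair n)) (lam0 : Pair n → ℝ)
    {Ω : Type*} {mΩ : MeasurableSpace Ω} (P : Measure Ω) (ℱ : Filtration ℕ mΩ)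
    (W : ℕ → Ω → Finset (Pair n)) (lam : ℕ → Ω → Pair n → ℝ) : Prop where
  measurable_W : ∀ m T, MeasurableSet[ℱ m] {ω | W m ω = T}
  measurable_lam : ∀ m, Measurable[ℱ m] (lam m)
  init_W : ∀ᵐ ω ∂P, W 0 ω = W0
  init_lam : ∀ᵐ ω ∂P, lam 0 ω = lam0 ∨ SolveReduced x ρ y mode W0 lam0 (lam 0 ω)
  augment : ∀ m, Augments x ρ y b r P (ℱ m) (W m) (lam m) (W (m + 1))
  solve : ∀ m, ∀ᵐ ω ∂P, SolveReduced x ρ y mode (W (m + 1) ω) (lam m ω) (lam (m + 1) ω)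

end

end ConvexRegression

/-!
The argument is a proximal Polyak–Łojasiewicz estimate combined with a sampling estimate.

Write `D` for the matrix with `Q = Dᵀ D`. The dual objective `L` is a function of `D λ` that is
quadratic with curvature `1` in `D λ`. Given `λ ≤ 0` and a competitor `z ≤ 0`, a Hoffman constant `μ`
of `D` yields a point `λ₀ ≤ 0` with `D λ₀ = D z`, so with the same objective value as `z`, towards
which `L` grows with curvature at least `μ`. Since `L` has curvature at most `σ`, a projected
gradient step with step size `1 / σ` on all of `Ω` is predicted to decrease `L` by at least
`(μ / σ) (L(λ) - L(z))` (`mul_sub_le_sum_modelDecrease`). It suffices to let `z` run through the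
feasible points; a minimizer of `L` is not needed.

The predicted decrease is a sum of nonnegative contributions of the entries (`modelDecrease`). A
reduced solve on `W` gains at least the contributions of the entries in `W`
(`dualObj_le_of_solveReduced`). An entry outside the active set has `λ_ω = 0`, and contributes
`max(-v_ω, 0)² / (2σ)`, which is larger the smaller `v_ω` is. So greedy selection takes at least, and
uniform sampling takes in expectation, the proportional share of the contributions of the inactive
entries. For each rule this share is at least `1 / α` (`Selects.exists_integrable_le`), and the
contributions of the active entries are collected in full. In expectation every iteration therefore
reduces the optimality gap by the factor `1 - μ / (σ α)` (`IsRun.integral_gap_succ_le`).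

A Hoffman constant exists for every matrix `D` (`exists_isHoffmanConstant`). The difference `w` of
two points of the negative orthant is shrunk entrywise towards `0`, without changing `D w`, until its
sign cone contains no nonzero kernel vector of `D`; the shrunk vector still leads to a feasible
point. On each of the finitely many sign cones without such kernel vectors, `D` is bounded below by
compactness.
-/

namespace ConvexRegression

/-! ### Existence of a Hoffman constant -/

section Hoffman

variable {ι κ : Type} [Fintype ι] [Fintype κ]

lemma sqNorm_nonneg (u : ι → ℝ) : 0 ≤ sqNorm u :=
  sum_nonneg fun _ _ => sq_nonneg _

lemma sqNorm_eq_zero {u : ι → ℝ} : sqNorm u = 0 ↔ u = 0 := by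
  simp [sqNorm, sum_eq_zero_iff_of_nonneg, sq_nonneg, funext_iff]

lemma sqNorm_pos {u : ι → ℝ} (hu : u ≠ 0) : 0 < sqNorm u :=
  lt_of_le_of_ne (sqNorm_nonneg u) fun h => hu (sqNorm_eq_zero.1 h.symm)

lemma sqNorm_smul (c : ℝ) (u : ι → ℝ) : sqNorm (c • u) = c ^ 2 * sqNorm u := by
  simp [sqNorm, mul_pow, mul_sum]

lemma sqNorm_neg (u : ι → ℝ) : sqNorm (-u) = sqNorm u := by
  simp [sqNorm]

lemma sqNorm_eq_dotProduct (u : ι → ℝ) : sqNorm u = u ⬝ᵥ u := by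
  simp [sqNorm, dotProduct, sq]

lemma continuous_sqNorm : Continuous (sqNorm : (ι → ℝ) → ℝ) := by
  unfold sqNorm
  fun_prop

/-- The closed cone of the vectors whose entries have, where they do not vanish, the signs
prescribed by `ε`; an entry with prescribed sign `0` has to vanish. -/
def signCone (ε : κ → SignType) : Set (κ → ℝ) :=
  {w | ∀ p, 0 ≤ (ε p : ℝ) * w p ∧ (ε p = 0 → w p = 0)}

omit [Fintype κ] in
lemma isClosed_signCone (ε : κ → SignType) : IsClosed (signCone ε) := by
  have : signCone ε = ⋂ p, {w : κ → ℝ | 0 ≤ (ε p : ℝ) * w p} ∩ {w | ε p = 0 → w p = 0} := by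
    ext w
    simp [signCone]
  rw [this]
  refine isClosed_iInter fun p => IsClosed.inter ?_ ?_
  · exact isClosed_le continuous_const (by fun_prop)
  · by_cases h : ε p = 0
    · simpa [h] using isClosed_eq (continuous_apply p) continuous_const
    · simp [h]

omit [Fintype κ] in
lemma smul_mem_signCone {ε : κ → SignType} {w : κ → ℝ} (hw : w ∈ signCone ε) {c : ℝ}
    (hc : 0 ≤ c) : c • w ∈ signCone ε := by
  intro p
  refine ⟨?_, fun h => by simp [(hw p).2 h]⟩
  have := mul_nonneg hc (hw p).1
  simp only [Pi.smul_apply, smul_eq_mul]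
  linarith

omit [Fintype κ] in
lemma mem_signCone_sign (w : κ → ℝ) : w ∈ signCone fun p => SignType.sign (w p) := by
  intro p
  refine ⟨?_, fun h => sign_eq_zero_iff.1 h⟩
  rw [sign_mul_self]
  exact abs_nonneg _

/-- On a sign cone that contains no nonzero kernel vector of `D`, the map `D` is bounded below:
this is compactness of the intersection of the cone with the unit sphere. -/
lemma exists_mul_sqNorm_le_of_signCone (D : Matrix ι κ ℝ) (ε : κ → SignType) :
    ∃ c : ℝ, 0 < c ∧ ((∀ k ∈ signCone ε, D *ᵥ k = 0 → k = 0) →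
      ∀ w ∈ signCone ε, c * sqNorm w ≤ sqNorm (D *ᵥ w)) := by
  by_cases hker : ∀ k ∈ signCone ε, D *ᵥ k = 0 → k = 0
  swap
  · exact ⟨1, one_pos, fun h => absurd h hker⟩
  have hcont : Continuous fun w : κ → ℝ => sqNorm (D *ᵥ w) :=
    continuous_sqNorm.comp (Continuous.matrix_mulVec continuous_const continuous_id)
  have hcomp : IsCompact (signCone ε ∩ {w : κ → ℝ | sqNorm w = 1}) := by
    refine Metric.isCompact_of_isClosed_isBounded
      ((isClosed_signCone ε).inter (isClosed_eq continuous_sqNorm continuous_const)) ?_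
    refine (Metric.isBounded_closedBall (x := (0 : κ → ℝ)) (r := 1)).subset ?_
    rintro w ⟨-, hw⟩
    rw [mem_closedBall_zero_iff, pi_norm_le_iff_of_nonneg zero_le_one]
    intro p
    have h1 : w p ^ 2 ≤ sqNorm w :=
      single_le_sum (f := fun i => w i ^ 2) (fun _ _ => sq_nonneg _) (mem_univ p)
    rw [Set.mem_ofPred_eq] at hw
    rw [Real.norm_eq_abs, ← sq_le_one_iff_abs_le_one]
    linarith
  have key : ∃ c : ℝ, 0 < c ∧ ∀ w ∈ signCone ε, sqNorm w = 1 → c ≤ sqNorm (D *ᵥ w) := by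
    rcases (signCone ε ∩ {w : κ → ℝ | sqNorm w = 1}).eq_empty_or_nonempty with he | hne
    · refine ⟨1, one_pos, fun w hw h1 => ?_⟩
      have : w ∈ signCone ε ∩ {w : κ → ℝ | sqNorm w = 1} := ⟨hw, h1⟩
      simp [he] at this
    · obtain ⟨w₀, ⟨hw₀, h₀⟩, hmin⟩ := hcomp.exists_isMinOn hne hcont.continuousOn
      refine ⟨sqNorm (D *ᵥ w₀), sqNorm_pos fun h => ?_, fun w hw h1 => hmin ⟨hw, h1⟩⟩
      have := hker w₀ hw₀ h
      subst this
      simp [sqNorm] at h₀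
  obtain ⟨c, hc, hle⟩ := key
  refine ⟨c, hc, fun _ w hw => ?_⟩
  rcases eq_or_ne w 0 with rfl | hne
  · simp [sqNorm]
  have hpos := sqNorm_pos hne
  have hs : (√(sqNorm w))⁻¹ ^ 2 = (sqNorm w)⁻¹ := by
    rw [inv_pow, Real.sq_sqrt hpos.le]
  have := hle ((√(sqNorm w))⁻¹ • w) (smul_mem_signCone hw (by positivity)) (by
    rw [sqNorm_smul, hs, inv_mul_cancel₀ hpos.ne'])
  rw [Matrix.mulVec_smul, sqNorm_smul, hs] at this
  rwa [inv_mul_eq_div, le_div_iff₀ hpos] at this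

omit [Fintype ι] in
/-- Every vector `w` can be shrunk entrywise towards `0`, without changing `D w`, to a vector whose
sign cone contains no nonzero kernel vector of `D`. -/
lemma exists_mem_uIcc_signCone_ker (D : Matrix ι κ ℝ) (w : κ → ℝ) :
    ∃ w' ∈ Set.uIcc 0 w, D *ᵥ w' = D *ᵥ w ∧
      ∀ k ∈ signCone fun p => SignType.sign (w' p), D *ᵥ k = 0 → k = 0 := by
  have hcomp : IsCompact (Set.uIcc 0 w ∩ {w' | D *ᵥ w' = D *ᵥ w}) := by
    refine (isCompact_Icc (a := 0 ⊓ w) (b := 0 ⊔ w)).inter_right (isClosed_eq ?_ continuous_const)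
    exact Continuous.matrix_mulVec continuous_const continuous_id
  have hcont : Continuous fun u : κ → ℝ => ∑ p, |u p| := by fun_prop
  obtain ⟨w', ⟨hw', hD⟩, hmin⟩ := hcomp.exists_isMinOn ⟨w, Set.right_mem_uIcc, rfl⟩
    hcont.continuousOn
  refine ⟨w', hw', hD, fun k hk hDk => ?_⟩
  -- Subtracting a small multiple of `k` from `w'` would decrease the `ℓ¹` norm.
  have hsmall : ∀ p, ∀ᶠ τ in nhdsWithin (0 : ℝ) (Set.Ioi 0), τ * |k p| ≤ |w' p| := by
    intro p
    rcases eq_or_ne (w' p) 0 with h0 | h0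
    · have : k p = 0 := (hk p).2 (by simp [h0])
      simp [this]
    · have ht : Filter.Tendsto (fun τ : ℝ => τ * |k p|) (nhdsWithin 0 (Set.Ioi 0))
          (nhds (0 * |k p|)) :=
        (Continuous.tendsto (by fun_prop) 0).mono_left nhdsWithin_le_nhds
      rw [zero_mul] at ht
      exact (ht.eventually_lt_const (abs_pos.2 h0)).mono fun _ h => h.le
  obtain ⟨τ, hτ, hτ0⟩ := ((Filter.eventually_all.2 hsmall).and self_mem_nhdsWithin).exists
  have habs : ∀ p, |w' p - τ * k p| = |w' p| - τ * |k p| ∧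
      w' p - τ * k p ∈ Set.uIcc 0 (w' p) := by
    intro p
    have hτp := hτ p
    have hkp := hk p
    rcases lt_trichotomy (w' p) 0 with h | h | h
    · have hk0 : k p ≤ 0 := by simpa [sign_neg h] using hkp.1
      rw [abs_of_nonpos hk0, abs_of_neg h] at *
      rw [Set.uIcc_of_ge h.le, Set.mem_Icc, abs_of_nonpos (by linarith)]
      refine ⟨by ring, ?_, by linarith⟩
      nlinarith
    · have hk0 : k p = 0 := hkp.2 (by simp [h])
      simp [h, hk0]
    · have hk0 : 0 ≤ k p := by simpa [sign_pos h] using hkp.1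
      rw [abs_of_nonneg hk0, abs_of_pos h] at *
      rw [Set.uIcc_of_le h.le, Set.mem_Icc, abs_of_nonneg (by linarith)]
      refine ⟨by ring, by linarith, ?_⟩
      nlinarith
  have hmem : w' - τ • k ∈ Set.uIcc 0 w ∩ {w' | D *ᵥ w' = D *ᵥ w} := by
    refine ⟨?_, ?_⟩
    · rw [← Set.pi_univ_uIcc] at hw' ⊢
      intro p _
      exact Set.uIcc_subset_uIcc_left (hw' p trivial) (habs p).2
    · simp only [Set.mem_ofPred_eq, Matrix.mulVec_sub, Matrix.mulVec_smul, hDk, smul_zero, sub_zero]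
      exact hD
  have hle : ∑ p, |w' p| ≤ ∑ p, |(w' - τ • k) p| := hmin hmem
  simp only [Pi.sub_apply, Pi.smul_apply, smul_eq_mul, (habs _).1, sum_sub_distrib,
    ← mul_sum] at hle
  have hsum : ∑ p, |k p| = 0 :=
    le_antisymm (by nlinarith) (sum_nonneg fun _ _ => abs_nonneg _)
  funext p
  simpa using (sum_eq_zero_iff_of_nonneg fun _ _ => abs_nonneg _).1 hsum p (mem_univ p)

/-- Hoffman's error bound for the polyhedra `{λ : D λ = s, λ ≤ 0}`. -/
theorem exists_isHoffmanConstant (D : Matrix ι κ ℝ) : ∃ μ, IsHoffmanConstant D μ := by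
  classical
  choose c hc hle using exists_mul_sqNorm_le_of_signCone D
  refine ⟨univ.inf' univ_nonempty c, (lt_inf'_iff _).2 fun ε _ => hc ε, ?_⟩
  rintro s ⟨z, rfl, hz⟩ lam hlam
  obtain ⟨w, hw, hD, hker⟩ := exists_mem_uIcc_signCone_ker D (z - lam)
  have hDs : D *ᵥ lam + D *ᵥ w = D *ᵥ z := by
    rw [hD, Matrix.mulVec_sub]
    abel
  refine ⟨lam + w, by rw [Matrix.mulVec_add, hDs], fun p => ?_, ?_⟩
  · rw [← Set.pi_univ_uIcc] at hw
    have hp : w p ≤ 0 ⊔ (z p - lam p) := (hw p trivial).2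
    have h1 := hz p
    have h2 := hlam p
    rw [Pi.add_apply]
    rcases le_sup_iff.1 hp with h | h <;> linarith
  · have h1 : lam - (lam + w) = -w := by abel
    have h2 : D *ᵥ lam - D *ᵥ z = -(D *ᵥ w) := by
      rw [← hDs]
      abel
    rw [h1, h2, sqNorm_neg, sqNorm_neg]
    exact (mul_le_mul_of_nonneg_right (inf'_le _ (mem_univ _)) (sqNorm_nonneg w)).trans
      (hle _ hker w (mem_signCone_sign w))

end Hoffman

/-! ### The largest eigenvalue and the quadratic form -/

section Deterministic

lemma dotProduct_mulVec_le_maxEigenvalue {ι : Type} [Fintype ι] [DecidableEq ι]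
    {M : Matrix ι ι ℝ} (hM : M.IsHermitian) (h : ι → ℝ) :
    h ⬝ᵥ (M *ᵥ h) ≤ maxEigenvalue hM * sqNorm h := by
  set U : Matrix ι ι ℝ := (hM.eigenvectorUnitary : Matrix ι ι ℝ)
  have hUU : U * Uᵀ = 1 := by
    have := Unitary.coe_mul_star_self hM.eigenvectorUnitary
    rwa [Unitary.coe_star, Matrix.star_eq_conjTranspose,
      Matrix.conjTranspose_eq_transpose_of_trivial] at this
  have hspec : M = U * Matrix.diagonal hM.eigenvalues * Uᵀ := by
    have := hM.spectral_theorem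
    rw [Unitary.conjStarAlgAut_apply, Matrix.star_eq_conjTranspose,
      Matrix.conjTranspose_eq_transpose_of_trivial] at this
    exact this
  set z := Uᵀ *ᵥ h with hz
  have hnorm : sqNorm h = sqNorm z := by
    rw [sqNorm_eq_dotProduct, sqNorm_eq_dotProduct, hz, Matrix.dotProduct_mulVec,
      Matrix.vecMul_transpose, Matrix.mulVec_mulVec, hUU, Matrix.one_mulVec]
  have hquad : h ⬝ᵥ (M *ᵥ h) = ∑ i, hM.eigenvalues i * z i ^ 2 := by
    conv_lhs => rw [hspec, ← Matrix.mulVec_mulVec, ← Matrix.mulVec_mulVec, ← hz,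
      Matrix.dotProduct_mulVec, ← Matrix.mulVec_transpose, ← hz]
    simp only [dotProduct, Matrix.mulVec_diagonal]
    exact sum_congr rfl fun i _ => by ring
  rw [hquad, hnorm, sqNorm, mul_sum]
  exact sum_le_sum fun i _ => mul_le_mul_of_nonneg_right
    (le_ciSup (Set.finite_range _).bddAbove i) (sq_nonneg _)

variable {n d : ℕ} (x : Fin n → EuclideanSpace ℝ (Fin d)) {ρ : ℝ} (y : Fin n → ℝ)

lemma matQ_eq_transpose_mul (hρ : 0 < ρ) : matQ x ρ = (matD x ρ)ᵀ * matD x ρ := by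
  have h : 1 / √ρ * (1 / √ρ) = 1 / ρ := by
    rw [div_mul_div_comm, one_mul, Real.mul_self_sqrt hρ.le]
  rw [matQ, matD, Matrix.transpose_fromRows, Matrix.fromCols_mul_fromRows,
    Matrix.transpose_smul, Matrix.transpose_transpose, Matrix.transpose_transpose,
    Matrix.smul_mul, Matrix.mul_smul, smul_smul, h]

lemma dotProduct_matQ_mulVec (hρ : 0 < ρ) (u w : Pair n → ℝ) :
    u ⬝ᵥ (matQ x ρ *ᵥ w) = (matD x ρ *ᵥ u) ⬝ᵥ (matD x ρ *ᵥ w) := by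
  rw [matQ_eq_transpose_mul x hρ, ← Matrix.mulVec_mulVec, Matrix.dotProduct_mulVec,
    Matrix.vecMul_transpose]

lemma sqNorm_matD_mulVec (hρ : 0 < ρ) (u : Pair n → ℝ) :
    sqNorm (matD x ρ *ᵥ u) = u ⬝ᵥ (matQ x ρ *ᵥ u) := by
  rw [dotProduct_matQ_mulVec x hρ, sqNorm_eq_dotProduct]

lemma sqNorm_matD_mulVec_le (hρ : 0 < ρ) (u : Pair n → ℝ) :
    sqNorm (matD x ρ *ᵥ u) ≤ smoothness x ρ * sqNorm u := by
  rw [sqNorm_matD_mulVec x hρ]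
  exact dotProduct_mulVec_le_maxEigenvalue _ _

/-- The entries outside `W` do not contribute to the quadratic form of `Q` at a vector supported
on `W`, so that the largest eigenvalue of the principal submatrix bounds it. -/
lemma sqNorm_matD_mulVec_le_of_support (hρ : 0 < ρ) {W : Finset (Pair n)} {u : Pair n → ℝ}
    (hu : ∀ p, p ∉ W → u p = 0) :
    sqNorm (matD x ρ *ᵥ u) ≤ smoothnessOn x ρ W * sqNorm u := by
  have hsum : ∀ f : Pair n → ℝ, (∀ p, p ∉ W → f p = 0) → ∑ p : W, f p = ∑ p, f p := by
    intro f hf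
    rw [sum_coe_sort W f]
    exact sum_subset (subset_univ _) fun p _ hp => hf p hp
  have h1 : sqNorm u = sqNorm fun p : W => u p :=
    (hsum (fun p => u p ^ 2) fun p hp => by simp [hu p hp]).symm
  have h2 : u ⬝ᵥ (matQ x ρ *ᵥ u) = (fun p : W => u p) ⬝ᵥ
      ((matQ x ρ).submatrix (Subtype.val : W → Pair n) Subtype.val *ᵥ fun p : W => u p) := by
    simp only [dotProduct, Matrix.mulVec, Matrix.submatrix_apply]
    rw [← hsum _ fun p hp => by rw [hu p hp, zero_mul]]
    exact sum_congr rfl fun p _ => by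
      rw [← hsum _ fun q hq => by rw [hu q hq, mul_zero]]
  rw [sqNorm_matD_mulVec x hρ, h1, h2]
  exact dotProduct_mulVec_le_maxEigenvalue _ _

/-! ### The dual objective -/

lemma dualObj_eq (hρ : 0 < ρ) (lam : Pair n → ℝ) :
    dualObj x ρ y lam = 1 / 2 * sqNorm (matD x ρ *ᵥ lam) - y ⬝ᵥ ((matA n)ᵀ *ᵥ lam) := by
  have h : ρ • (matA n * (matA n)ᵀ) + matB x * (matB x)ᵀ = ρ • matQ x ρ := by
    rw [matQ, smul_add, smul_smul, mul_one_div_cancel hρ.ne', one_smul]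
  rw [dualObj, h, sqNorm_matD_mulVec x hρ, Matrix.smul_mulVec, dotProduct_smul, smul_eq_mul]
  congr 1
  field_simp

lemma dualObj_add (hρ : 0 < ρ) (lam h : Pair n → ℝ) :
    dualObj x ρ y (lam + h) = dualObj x ρ y lam + dualGrad x ρ y lam ⬝ᵥ h
      + 1 / 2 * sqNorm (matD x ρ *ᵥ h) := by
  have h1 : sqNorm (matD x ρ *ᵥ (lam + h)) = sqNorm (matD x ρ *ᵥ lam)
      + 2 * ((matQ x ρ *ᵥ lam) ⬝ᵥ h) + sqNorm (matD x ρ *ᵥ h) := by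
    rw [dotProduct_comm _ h, dotProduct_matQ_mulVec x hρ, sqNorm_eq_dotProduct,
      sqNorm_eq_dotProduct, sqNorm_eq_dotProduct, Matrix.mulVec_add, add_dotProduct,
      dotProduct_add, dotProduct_add, dotProduct_comm (matD x ρ *ᵥ lam) (matD x ρ *ᵥ h)]
    ring
  have h2 : y ⬝ᵥ ((matA n)ᵀ *ᵥ h) = (matA n *ᵥ y) ⬝ᵥ h := by
    rw [Matrix.dotProduct_mulVec, Matrix.vecMul_transpose]
  rw [dualObj_eq x y hρ, dualObj_eq x y hρ, h1, Matrix.mulVec_add, dotProduct_add, h2,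
    dualGrad, sub_dotProduct]
  ring

/-- The dual objective depends on `λ` only through `D λ`: the linear term is a function of the
block `Aᵀ λ` of `D λ`. -/
lemma dualObj_congr (hρ : 0 < ρ) {lam z : Pair n → ℝ} (h : matD x ρ *ᵥ lam = matD x ρ *ᵥ z) :
    dualObj x ρ y lam = dualObj x ρ y z := by
  have hA : (matA n)ᵀ *ᵥ lam = (matA n)ᵀ *ᵥ z := by
    rw [matD, Matrix.fromRows_mulVec, Matrix.fromRows_mulVec] at h
    exact (Sum.elim_eq_iff.1 h).1
  rw [dualObj_eq x y hρ, dualObj_eq x y hρ, h, hA]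

lemma neg_sqNorm_le_dualObj (hρ : 0 < ρ) (lam : Pair n → ℝ) :
    -(1 / 2 * sqNorm y) ≤ dualObj x ρ y lam := by
  have h1 : sqNorm ((matA n)ᵀ *ᵥ lam) ≤ sqNorm (matD x ρ *ᵥ lam) := by
    rw [matD, Matrix.fromRows_mulVec]
    simp only [sqNorm, Fintype.sum_sum_type, Sum.elim_inl, Sum.elim_inr]
    exact le_add_of_nonneg_right (sum_nonneg fun _ _ => sq_nonneg _)
  have h2 : 0 ≤ sqNorm ((matA n)ᵀ *ᵥ lam - y) := sqNorm_nonneg _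
  rw [sqNorm_eq_dotProduct, sub_dotProduct, dotProduct_sub, dotProduct_sub,
    ← sqNorm_eq_dotProduct, ← sqNorm_eq_dotProduct, dotProduct_comm _ y] at h2
  rw [dualObj_eq x y hρ]
  linarith

lemma le_dualOpt {a : ℝ} (h : ∀ z : Pair n → ℝ, (∀ p, z p ≤ 0) → a ≤ dualObj x ρ y z) :
    a ≤ dualOpt x ρ y := by
  refine le_csInf ⟨_, 0, fun _ => le_rfl, rfl⟩ ?_
  rintro _ ⟨z, hz, rfl⟩
  exact h z hz

lemma continuous_dualObj (hρ : 0 < ρ) : Continuous (dualObj x ρ y) := by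
  have : dualObj x ρ y =
      fun lam => 1 / 2 * sqNorm (matD x ρ *ᵥ lam) - y ⬝ᵥ ((matA n)ᵀ *ᵥ lam) :=
    funext fun lam => dualObj_eq x y hρ lam
  rw [this]
  have h1 : Continuous fun lam : Pair n → ℝ => matD x ρ *ᵥ lam :=
    Continuous.matrix_mulVec continuous_const continuous_id
  have h2 : Continuous fun lam : Pair n → ℝ => (matA n)ᵀ *ᵥ lam :=
    Continuous.matrix_mulVec continuous_const continuous_id
  exact ((continuous_sqNorm.comp h1).const_mul _).sub (continuous_const.dotProduct h2)

lemma violation_eq_neg_dualGrad (lam : Pair n → ℝ) :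
    violation x ρ y lam = -dualGrad x ρ y lam := by
  rw [violation, primalPhi, primalXi, dualGrad, matQ, Matrix.mulVec_sub, Matrix.mulVec_neg,
    Matrix.mulVec_smul, Matrix.mulVec_mulVec, Matrix.mulVec_mulVec, Matrix.add_mulVec,
    Matrix.smul_mulVec]
  abel

lemma continuous_dualGrad : Continuous (dualGrad x ρ y) := by
  unfold dualGrad
  exact (Continuous.matrix_mulVec continuous_const continuous_id).sub continuous_const

/-! ### The smoothness constant -/

lemma matD_mulVec_single_ne_zero (p : Pair n) : matD x ρ *ᵥ Pi.single p (-1) ≠ 0 := by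
  intro h
  have := congrFun h (Sum.inl p.1.1)
  simp [matD, matA, p.2] at this

lemma hoffman_le_smoothness (hρ : 0 < ρ) {μ : ℝ} (hμ : IsHoffmanConstant (matD x ρ) μ)
    (p : Pair n) : μ ≤ smoothness x ρ := by
  set e : Pair n → ℝ := Pi.single p (-1) with he
  obtain ⟨z, hz, -, hle⟩ := hμ.2 (matD x ρ *ᵥ e) ⟨e, rfl, fun k => by
    rw [he, Pi.single_apply]
    split_ifs <;> norm_num⟩ 0 fun _ => le_rfl
  have hne : z ≠ 0 := by
    rintro rfl
    rw [Matrix.mulVec_zero] at hz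
    exact matD_mulVec_single_ne_zero x p hz.symm
  rw [Matrix.mulVec_zero, zero_sub, zero_sub, sqNorm_neg, sqNorm_neg, ← hz] at hle
  exact le_of_mul_le_mul_right (hle.trans (sqNorm_matD_mulVec_le x hρ z)) (sqNorm_pos hne)

/-! ### The decrease of the objective by a projected gradient step -/

/-- The negative of the minimum over `h ≤ -a` of the model `g h + σ h² / 2`, attained at the
projected gradient step `h = min 0 (a - g / σ) - a`. -/
noncomputable def modelDecrease (σ g a : ℝ) : ℝ :=
  -(g * (min 0 (a - g / σ) - a) + σ / 2 * (min 0 (a - g / σ) - a) ^ 2)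

lemma projStep_minimizes {t g a w : ℝ} (ht : 0 < t) (hw : w ≤ 0) :
    g * (min 0 (a - t * g) - a) + 1 / (2 * t) * (min 0 (a - t * g) - a) ^ 2
      ≤ g * (w - a) + 1 / (2 * t) * (w - a) ^ 2 := by
  set u := min 0 (a - t * g) with hu
  have key : 0 ≤ (w - u) * (u - (a - t * g)) := by
    rcases le_total 0 (a - t * g) with h | h
    · rw [hu, min_eq_left h]
      nlinarith
    · rw [hu, min_eq_right h]
      simp
  have h1 : g * (w - a) + 1 / (2 * t) * (w - a) ^ 2 - (g * (u - a) + 1 / (2 * t) * (u - a) ^ 2)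
      = 1 / t * ((w - u) * (u - (a - t * g))) + 1 / (2 * t) * (w - u) ^ 2 := by
    field_simp
    ring
  have h2 : 0 ≤ 1 / t * ((w - u) * (u - (a - t * g))) + 1 / (2 * t) * (w - u) ^ 2 := by
    positivity
  linarith

lemma neg_modelDecrease_le {σ g a w : ℝ} (hσ : 0 < σ) (hw : w ≤ 0) :
    -modelDecrease σ g a ≤ g * (w - a) + σ / 2 * (w - a) ^ 2 := by
  have h := projStep_minimizes (g := g) (a := a) (inv_pos.2 hσ) hw
  have e : 1 / (2 * σ⁻¹) = σ / 2 := by field_simp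
  rw [e, inv_mul_eq_div] at h
  rw [modelDecrease, neg_neg]
  exact h

lemma modelDecrease_nonneg {σ g a : ℝ} (hσ : 0 < σ) (ha : a ≤ 0) : 0 ≤ modelDecrease σ g a := by
  have := neg_modelDecrease_le (g := g) (a := a) hσ ha
  simp only [sub_self] at this
  linarith

/-- At a vanishing entry only a positive partial derivative, that is a violated constraint,
allows a decrease. -/
lemma modelDecrease_zero {σ g : ℝ} (hσ : 0 < σ) :
    modelDecrease σ g 0 = max g 0 ^ 2 / (2 * σ) := by
  rw [modelDecrease]
  rcases le_total g 0 with h | h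
  · rw [max_eq_right h, min_eq_left (by
      have := div_nonpos_of_nonpos_of_nonneg h hσ.le
      linarith)]
    simp
  · rw [max_eq_left h, min_eq_right (by
      have := div_nonneg h hσ.le
      linarith)]
    field_simp
    ring

lemma reducedFeasible_proxStep (W : Finset (Pair n)) (t : ℝ) (lam : Pair n → ℝ) :
    ReducedFeasible W (proxStep x ρ y W t lam) := by
  refine ⟨fun p => ?_, fun p hp => by simp [proxStep, hp]⟩
  rw [proxStep]
  split_ifs
  · exact min_le_left _ _
  · exact le_rfl

/-- A proximal gradient step on `W` whose step size is at least `1 / σ`, and at most the inverse of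
the curvature of the objective along the step, gains the decrease that the model with curvature
`σ` predicts for the entries in `W`. -/
lemma dualObj_proxStep_le (hρ : 0 < ρ) {W : Finset (Pair n)} {t : ℝ} {lam : Pair n → ℝ}
    (hlam : ReducedFeasible W lam) (hσ : 0 < smoothness x ρ) (ht : 1 ≤ smoothness x ρ * t)
    (ht' : t * sqNorm (matD x ρ *ᵥ (proxStep x ρ y W t lam - lam))
      ≤ sqNorm (proxStep x ρ y W t lam - lam)) :
    dualObj x ρ y (proxStep x ρ y W t lam) ≤ dualObj x ρ y lam
      - ∑ p ∈ W, modelDecrease (smoothness x ρ) (dualGrad x ρ y lam p) (lam p) := by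
  set σ := smoothness x ρ
  set g := dualGrad x ρ y lam
  set h := proxStep x ρ y W t lam - lam with hh
  have ht0 : 0 < t := by
    by_contra hcon
    nlinarith
  have hinv : 1 / (2 * t) ≤ σ / 2 := by
    rw [div_le_iff₀ (by positivity)]
    linarith
  have hoff : ∀ p, p ∉ W → h p = 0 := fun p hp => by
    simp [hh, proxStep, hp, hlam.2 p hp]
  have hcurv : 1 / 2 * sqNorm (matD x ρ *ᵥ h) ≤ 1 / (2 * t) * sqNorm h := by
    have : 1 / (2 * t) * (t * sqNorm (matD x ρ *ᵥ h)) ≤ 1 / (2 * t) * sqNorm h :=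
      mul_le_mul_of_nonneg_left ht' (by positivity)
    have e : 1 / (2 * t) * (t * sqNorm (matD x ρ *ᵥ h)) = 1 / 2 * sqNorm (matD x ρ *ᵥ h) := by
      field_simp
    linarith
  have hsum : g ⬝ᵥ h + 1 / (2 * t) * sqNorm h
      ≤ ∑ p ∈ W, -modelDecrease σ (g p) (lam p) := by
    have e : g ⬝ᵥ h + 1 / (2 * t) * sqNorm h
        = ∑ p ∈ W, (g p * h p + 1 / (2 * t) * h p ^ 2) := by
      rw [dotProduct, sqNorm, mul_sum, ← sum_add_distrib]
      exact (sum_subset (subset_univ _) fun p _ hp => by simp [hoff p hp]).symm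
    rw [e]
    refine sum_le_sum fun p hp => ?_
    have hp' : h p = min 0 (lam p - t * g p) - lam p := by simp [hh, proxStep, hp, g]
    have h1 := projStep_minimizes (g := g p) (a := lam p) ht0
      (min_le_left 0 (lam p - g p / σ))
    rw [hp', modelDecrease, neg_neg]
    exact h1.trans (add_le_add_right (mul_le_mul_of_nonneg_right hinv (sq_nonneg _)) _)
  have hadd : proxStep x ρ y W t lam = lam + h := by
    rw [hh]
    abel
  rw [hadd, dualObj_add x y hρ]
  rw [sum_neg_distrib] at hsum
  linarith

/-- The proximal Polyak–Łojasiewicz inequality. The Hoffman bound supplies a point `λ₀` with the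
same objective value as `z` towards which the objective grows with curvature `μ`; the step
`μ / σ (λ₀ - λ)` then witnesses the predicted decrease. -/
lemma mul_sub_le_sum_modelDecrease (hρ : 0 < ρ) {μ : ℝ}
    (hμ : IsHoffmanConstant (matD x ρ) μ) (hσ : 0 < smoothness x ρ) (hμσ : μ ≤ smoothness x ρ)
    {lam z : Pair n → ℝ} (hlam : ∀ p, lam p ≤ 0) (hz : ∀ p, z p ≤ 0) :
    μ / smoothness x ρ * (dualObj x ρ y lam - dualObj x ρ y z)
      ≤ ∑ p, modelDecrease (smoothness x ρ) (dualGrad x ρ y lam p) (lam p) := by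
  set σ := smoothness x ρ
  set g := dualGrad x ρ y lam
  obtain ⟨lam₀, hD, hlam₀, hle⟩ := hμ.2 _ ⟨z, rfl, hz⟩ lam hlam
  set η := μ / σ with hη
  have hη0 : 0 ≤ η := div_nonneg hμ.1.le hσ.le
  have hη1 : η ≤ 1 := (div_le_one hσ).2 hμσ
  have hση : σ * η = μ := by
    rw [hη]
    field_simp
  set w := lam₀ - lam with hw
  have hLz : dualObj x ρ y z = dualObj x ρ y lam + g ⬝ᵥ w
      + 1 / 2 * sqNorm (matD x ρ *ᵥ w) := by
    rw [← dualObj_add x y hρ, hw, add_sub_cancel, dualObj_congr x y hρ hD]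
  have hgrow : μ * sqNorm w ≤ sqNorm (matD x ρ *ᵥ w) := by
    rw [hw, ← sqNorm_neg (lam₀ - lam), neg_sub, ← sqNorm_neg (matD x ρ *ᵥ _),
      ← Matrix.mulVec_neg, neg_sub, Matrix.mulVec_sub, hD]
    exact hle
  have hsum : ∑ p, -modelDecrease σ (g p) (lam p)
      ≤ ∑ p, (η * (g p * w p) + η * (μ / 2) * w p ^ 2) := by
    refine sum_le_sum fun p _ => ?_
    have hp : lam p + η * w p ≤ 0 := by
      have h1 := hlam p
      have h2 := hlam₀ p
      simp only [hw, Pi.sub_apply]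
      nlinarith
    have := neg_modelDecrease_le (g := g p) (a := lam p) hσ hp
    rw [← hση]
    linarith [this, show g p * (lam p + η * w p - lam p) + σ / 2 * (lam p + η * w p - lam p) ^ 2
      = η * (g p * w p) + η * (σ * η / 2) * w p ^ 2 by ring]
  rw [sum_neg_distrib, sum_add_distrib, ← mul_sum, ← mul_sum] at hsum
  have e1 : ∑ p, g p * w p = g ⬝ᵥ w := rfl
  have e2 : ∑ p, w p ^ 2 = sqNorm w := rfl
  rw [e1, e2] at hsum
  have h3 : η * (μ * sqNorm w) ≤ η * sqNorm (matD x ρ *ᵥ w) :=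
    mul_le_mul_of_nonneg_left hgrow hη0
  rw [hLz]
  linarith

/-! ### The reduced solves -/

lemma solveReduced_feasible {mode : Mode} {W : Finset (Pair n)} {lam lam' : Pair n → ℝ}
    (h : SolveReduced x ρ y mode W lam lam') : ReducedFeasible W lam' := by
  cases mode with
  | EAS => exact h.1
  | ASGD =>
    cases h with
    | single h =>
      obtain ⟨t, -, -, rfl⟩ := h
      exact reducedFeasible_proxStep x y W t _
    | tail _ h =>
      obtain ⟨t, -, -, rfl⟩ := h
      exact reducedFeasible_proxStep x y W t _

/-- Both kinds of reduced solve gain at least the decrease predicted by the model on `W`: a first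
proximal gradient step gains it, further steps do not increase the objective, and an exact
solution is at least as good as a single step of size `1 / σ`. -/
lemma dualObj_le_of_solveReduced (hρ : 0 < ρ) (hσ : 0 < smoothness x ρ) {mode : Mode}
    {W : Finset (Pair n)} {lam lam' : Pair n → ℝ} (hlam : ReducedFeasible W lam)
    (h : SolveReduced x ρ y mode W lam lam') :
    dualObj x ρ y lam' ≤ dualObj x ρ y lam
      - ∑ p ∈ W, modelDecrease (smoothness x ρ) (dualGrad x ρ y lam p) (lam p) := by
  cases mode with
  | EAS =>
    refine (h.2 _ (reducedFeasible_proxStep x y W (smoothness x ρ)⁻¹ lam)).trans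
      (dualObj_proxStep_le x y hρ hlam hσ (mul_inv_cancel₀ hσ.ne').ge ?_)
    rw [inv_mul_le_iff₀ hσ]
    exact sqNorm_matD_mulVec_le x hρ _
  | ASGD =>
    have step : ∀ z z' : Pair n → ℝ, ReducedFeasible W z →
        (∃ t : ℝ, 1 ≤ smoothness x ρ * t ∧ smoothnessOn x ρ W * t ≤ 1 ∧
          z' = proxStep x ρ y W t z) →
        ReducedFeasible W z' ∧ dualObj x ρ y z' ≤ dualObj x ρ y z
          - ∑ p ∈ W, modelDecrease (smoothness x ρ) (dualGrad x ρ y z p) (z p) := by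
      rintro z _ hz ⟨t, h1, h2, rfl⟩
      have ht0 : 0 < t := by
        by_contra hcon
        nlinarith
      refine ⟨reducedFeasible_proxStep x y W t z, dualObj_proxStep_le x y hρ hz hσ h1 ?_⟩
      have hle := sqNorm_matD_mulVec_le_of_support x hρ (W := W)
        (u := proxStep x ρ y W t z - z) fun p hp => by
          simp [(reducedFeasible_proxStep x y W t z).2 p hp, hz.2 p hp]
      calc t * sqNorm (matD x ρ *ᵥ (proxStep x ρ y W t z - z))
          ≤ t * (smoothnessOn x ρ W * sqNorm (proxStep x ρ y W t z - z)) :=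
            mul_le_mul_of_nonneg_left hle ht0.le
        _ = smoothnessOn x ρ W * t * sqNorm (proxStep x ρ y W t z - z) := by ring
        _ ≤ 1 * sqNorm (proxStep x ρ y W t z - z) :=
            mul_le_mul_of_nonneg_right h2 (sqNorm_nonneg _)
        _ = _ := one_mul _
    suffices hs : ReducedFeasible W lam' ∧ dualObj x ρ y lam' ≤ dualObj x ρ y lam
        - ∑ p ∈ W, modelDecrease (smoothness x ρ) (dualGrad x ρ y lam p) (lam p) from hs.2
    induction h with
    | single h => exact step _ _ hlam h
    | tail _ h ih =>
      obtain ⟨hf, hle⟩ := step _ _ ih.1 h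
      refine ⟨hf, ?_⟩
      exact (hle.trans (sub_le_self _ (sum_nonneg fun p _ =>
        modelDecrease_nonneg hσ (ih.1.1 p)))).trans ih.2

lemma dualObj_le_dualObj_of_solveReduced (hρ : 0 < ρ) (hσ : 0 < smoothness x ρ) {mode : Mode}
    {W : Finset (Pair n)} {lam lam' : Pair n → ℝ} (hlam : ReducedFeasible W lam)
    (h : SolveReduced x ρ y mode W lam lam') : dualObj x ρ y lam' ≤ dualObj x ρ y lam := by
  have h1 := dualObj_le_of_solveReduced x y hρ hσ hlam h
  have h2 : 0 ≤ ∑ p ∈ W, modelDecrease (smoothness x ρ) (dualGrad x ρ y lam p) (lam p) :=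
    sum_nonneg fun p _ => modelDecrease_nonneg hσ (hlam.1 p)
  linarith

end Deterministic

/-! ### Greedy selection and uniform sampling of a finite set -/

section Selection

variable {ι : Type} [DecidableEq ι]

/-- If `f` decreases in `v`, then the elements with the smallest `v` carry at least their
proportional share of the total `f`. -/
lemma IsSmallest.mul_sum_le {S T : Finset ι} {k N : ℕ} {v f : ι → ℝ} (hT : IsSmallest S k v T)
    (hf : ∀ a ∈ S, 0 ≤ f a) (hmono : ∀ a ∈ S, ∀ b ∈ S, v a ≤ v b → f b ≤ f a)
    (hk : k ≤ N) (hS : #S ≤ N) : (k : ℝ) * ∑ a ∈ S, f a ≤ N * ∑ a ∈ T, f a := by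
  obtain ⟨hTS, hcard, hle⟩ := hT
  have hT0 : 0 ≤ ∑ a ∈ T, f a := sum_nonneg fun a ha => hf a (hTS ha)
  rcases le_total #S k with h | h
  · obtain rfl := eq_of_subset_of_card_le hTS (by omega)
    exact mul_le_mul_of_nonneg_right (by exact_mod_cast hk) hT0
  · rw [min_eq_left h] at hcard
    have hdouble : (#T : ℝ) * ∑ b ∈ S \ T, f b ≤ #(S \ T) * ∑ a ∈ T, f a := by
      have : ∑ a ∈ T, ∑ b ∈ S \ T, f b ≤ ∑ a ∈ T, ∑ b ∈ S \ T, f a :=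
        sum_le_sum fun a ha => sum_le_sum fun b hb =>
          hmono a (hTS ha) b (mem_sdiff.1 hb).1 (hle a ha b hb)
      simpa [← mul_sum] using this
    have hsplit := sum_sdiff hTS (f := f)
    have hcs : (#(S \ T) : ℝ) + #T = #S := by
      exact_mod_cast card_sdiff_add_card_eq_card hTS
    have hN : (#S : ℝ) ≤ N := by exact_mod_cast hS
    rw [← hcard, ← hsplit]
    nlinarith

lemma card_filter_mem_powersetCard_succ {S : Finset ι} {a : ι} (ha : a ∈ S) (k : ℕ) :
    #{T ∈ S.powersetCard (k + 1) | a ∈ T} = (#S - 1).choose k := by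
  rw [← card_erase_of_mem ha, ← card_powersetCard]
  refine (card_bij (fun T _ => insert a T) ?_ ?_ ?_).symm
  · intro T hT
    obtain ⟨hTS, hcard⟩ := mem_powersetCard.1 hT
    have haT : a ∉ T := fun h => notMem_erase a S (hTS h)
    exact mem_filter.2 ⟨mem_powersetCard.2 ⟨insert_subset ha (hTS.trans (erase_subset _ _)),
      by rw [card_insert_of_notMem haT, hcard]⟩, mem_insert_self _ _⟩
  · intro T hT T' hT' h
    have haT : a ∉ T := fun h => notMem_erase a S ((mem_powersetCard.1 hT).1 h)
    have haT' : a ∉ T' := fun h => notMem_erase a S ((mem_powersetCard.1 hT').1 h)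
    rw [← erase_insert haT, h, erase_insert haT']
  · intro T hT
    obtain ⟨hT, haT⟩ := mem_filter.1 hT
    obtain ⟨hTS, hcard⟩ := mem_powersetCard.1 hT
    exact ⟨T.erase a, mem_powersetCard.2 ⟨erase_subset_erase _ hTS,
      by rw [card_erase_of_mem haT, hcard, Nat.add_sub_cancel]⟩, insert_erase haT⟩

/-- A uniformly random `k`-element subset of `S` contains each element of `S` with probability
`k / #S`. -/
lemma card_mul_expect_powersetCard_sum {S : Finset ι} {k : ℕ} (hk : k ≤ #S) (f : ι → ℝ) :
    (#S : ℝ) * (S.powersetCard k).expect (fun T => ∑ a ∈ T, f a) = k * ∑ a ∈ S, f a := by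
  rcases k with _ | k
  · simp
  have hS : #S = (#S - 1) + 1 := by omega
  have hsum : ∑ T ∈ S.powersetCard (k + 1), ∑ a ∈ T, f a
      = (#S - 1).choose k * ∑ a ∈ S, f a := by
    rw [sum_comm' (t' := S) (s' := fun a => {T ∈ S.powersetCard (k + 1) | a ∈ T}), mul_sum]
    · refine sum_congr rfl fun a ha => ?_
      rw [sum_const, card_filter_mem_powersetCard_succ ha, nsmul_eq_mul]
    · intro T a
      simp only [mem_filter]
      refine ⟨fun h => ⟨⟨h.1, h.2⟩, (mem_powersetCard.1 h.1).1 h.2⟩, fun h => h.1⟩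
  have hchoose : (#S : ℝ) * (#S - 1).choose k = (#S).choose (k + 1) * (k + 1) := by
    have := Nat.add_one_mul_choose_eq (#S - 1) k
    rw [← hS] at this
    exact_mod_cast this
  have hpos : (0 : ℝ) < (#S).choose (k + 1) := by exact_mod_cast Nat.choose_pos hk
  rw [expect_eq_sum_div_card, hsum, card_powersetCard, mul_div_assoc', ← mul_assoc, hchoose,
    div_eq_iff hpos.ne']
  push_cast
  ring

lemma mul_sum_le_expect_powersetCard_sum {S : Finset ι} {k N : ℕ} {f : ι → ℝ}
    (hf : ∀ a ∈ S, 0 ≤ f a) (hk : k ≤ N) (hS : #S ≤ N) :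
    (k : ℝ) * ∑ a ∈ S, f a ≤
      N * (S.powersetCard (min k #S)).expect fun T => ∑ a ∈ T, f a := by
  have h0 : 0 ≤ ∑ a ∈ S, f a := sum_nonneg hf
  have hN : (#S : ℝ) ≤ N := by exact_mod_cast hS
  rcases le_total #S k with h | h
  · rw [min_eq_right h, powersetCard_self, expect_singleton]
    exact mul_le_mul_of_nonneg_right (by exact_mod_cast hk) h0
  · rw [min_eq_left h, ← card_mul_expect_powersetCard_sum h]
    refine mul_le_mul_of_nonneg_right hN (expect_nonneg fun T hT => ?_)
    exact sum_nonneg fun a ha => hf a ((mem_powersetCard.1 hT).1 ha)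

lemma isSmallest_largest (S : Finset ι) (k : ℕ) (θ : ι → ℝ) :
    IsSmallest S k (fun a => -|θ a|) (largest S k θ) :=
  (exists_isSmallest S k fun a => -|θ a|).choose_spec

lemma mul_sum_sq_le_sum_largest {S : Finset ι} {k N : ℕ} (θ : ι → ℝ) (hk : k ≤ N)
    (hS : #S ≤ N) : (k : ℝ) * ∑ a ∈ S, θ a ^ 2 ≤ N * ∑ a ∈ largest S k θ, θ a ^ 2 :=
  (isSmallest_largest S k θ).mul_sum_le (fun _ _ => sq_nonneg _)
    (fun _ _ _ _ h => sq_le_sq.2 (neg_le_neg_iff.1 h)) hk hS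

end Selection

/-! ### The blocks, and the norms of the rules -/

section Blocks

variable {n : ℕ}

lemma sum_sum_block (b : BlockKind) (f : Pair n → ℝ) :
    ∑ i, ∑ p ∈ block b i, f p = ∑ p, f p := by
  cases b with
  | first => exact sum_fiberwise _ (fun p : Pair n => p.1.1) f
  | second => exact sum_fiberwise _ (fun p : Pair n => p.1.2) f

lemma disjoint_block (b : BlockKind) {i j : Fin n} (h : i ≠ j) :
    Disjoint (block b i) (block b j) := by
  rw [disjoint_left]
  cases b <;>
  · intro p hi hj
    simp only [block, mem_filter] at hi hj
    exact h (hi.2.symm.trans hj.2)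

lemma sum_biUnion_of_subset_block (b : BlockKind) (I : Finset (Fin n))
    {T : Fin n → Finset (Pair n)} (hT : ∀ i ∈ I, T i ⊆ block b i) (f : Pair n → ℝ) :
    ∑ p ∈ I.biUnion T, f p = ∑ i ∈ I, ∑ p ∈ T i, f p :=
  sum_biUnion fun i hi j hj hij => (disjoint_block b hij).mono (hT i hi) (hT j hj)

lemma card_block (b : BlockKind) (i : Fin n) : #(block b i) = n - 1 := by
  have herase : #(univ.erase i) = n - 1 := by simp
  rw [← herase]
  cases b with
  | first =>
    refine card_bij (fun p _ => p.1.2) ?_ ?_ ?_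
    · rintro ⟨⟨a, c⟩, hne⟩ hp
      simp only [block, mem_filter, mem_univ, true_and] at hp
      subst hp
      exact mem_erase.2 ⟨Ne.symm hne, mem_univ _⟩
    · rintro ⟨⟨a, c⟩, hne⟩ hp ⟨⟨a', c'⟩, hne'⟩ hp' h
      simp only [block, mem_filter, mem_univ, true_and] at hp hp' h
      subst hp hp' h
      rfl
    · intro j hj
      exact ⟨⟨(i, j), (mem_erase.1 hj).1.symm⟩, by simp [block], rfl⟩
  | second =>
    refine card_bij (fun p _ => p.1.1) ?_ ?_ ?_
    · rintro ⟨⟨a, c⟩, hne⟩ hp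
      simp only [block, mem_filter, mem_univ, true_and] at hp
      subst hp
      exact mem_erase.2 ⟨hne, mem_univ _⟩
    · rintro ⟨⟨a, c⟩, hne⟩ hp ⟨⟨a', c'⟩, hne'⟩ hp' h
      simp only [block, mem_filter, mem_univ, true_and] at hp hp' h
      subst hp hp' h
      rfl
    · intro j hj
      exact ⟨⟨(j, i), (mem_erase.1 hj).1⟩, by simp [block], rfl⟩

lemma card_univ_pair : #(univ : Finset (Pair n)) = n * (n - 1) := by
  have h := sum_sum_block (n := n) BlockKind.first fun _ => 1
  simp only [sum_const, card_block, nsmul_eq_mul, mul_one, card_fin] at h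
  exact_mod_cast h.symm

lemma Rule.Valid.two_le {r : Rule} (hr : r.Valid n) : 2 ≤ n := by
  have key : ∀ k, 1 ≤ k → k ≤ n * (n - 1) → 2 ≤ n := by
    intro k h1 h2
    by_contra hn
    have : n * (n - 1) = 0 := by
      rcases (by omega : n = 0 ∨ n = 1) with rfl | rfl <;> rfl
    omega
  cases r with
  | greedyBlock P =>
    have := hr.1
    have := hr.2
    omega
  | random K => exact key K hr.1 hr.2
  | randomBlock P =>
    have := hr.1
    have := hr.2
    omega
  | randomGreedy M K => exact key M (hr.1.trans hr.2.1) hr.2.2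
  | randomBlockGreedy G P =>
    have := hr.2.2.1
    have := hr.2.2.2
    omega

lemma Rule.Valid.one_le_alpha {r : Rule} (hr : r.Valid n) : 1 ≤ r.alpha n := by
  have hn := hr.two_le
  have hc : ((n - 1 : ℕ) : ℝ) = (n : ℝ) - 1 := by
    rw [Nat.cast_sub (by omega), Nat.cast_one]
  cases r with
  | greedyBlock P =>
    obtain ⟨h1, h2⟩ := hr
    rw [Rule.alpha, one_le_div (by exact_mod_cast h1), ← hc]
    exact_mod_cast h2
  | random K =>
    obtain ⟨h1, h2⟩ := hr
    rw [Rule.alpha, one_le_div (by exact_mod_cast h1), ← hc]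
    exact_mod_cast h2
  | randomBlock P =>
    obtain ⟨h1, h2⟩ := hr
    rw [Rule.alpha, one_le_div (by exact_mod_cast h1), ← hc]
    exact_mod_cast h2
  | randomGreedy M K =>
    obtain ⟨h1, h2, h3⟩ := hr
    rw [Rule.alpha, one_le_div (by exact_mod_cast h1), ← hc]
    exact_mod_cast h2.trans h3
  | randomBlockGreedy G P =>
    obtain ⟨h1, h2, h3, h4⟩ := hr
    rw [Rule.alpha, one_le_div (by exact_mod_cast Nat.mul_pos h1 h3), ← hc]
    exact_mod_cast Nat.mul_le_mul h2 h4

lemma le_div_mul_of_mul_le {a s N k : ℝ} (hk : 0 < k) (h : k * a ≤ N * s) : a ≤ N / k * s := by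
  rw [div_mul_eq_mul_div, le_div_iff₀ hk]
  linarith

/-- The norm equivalence `‖θ‖² ≤ α ‖θ‖²_rule`. -/
theorem sqNorm_le_alpha_mul_ruleNormSq (b : BlockKind) {r : Rule} (hr : r.Valid n)
    (θ : Pair n → ℝ) : sqNorm θ ≤ r.alpha n * ruleNormSq b r θ := by
  have hn := hr.two_le
  have hc : ((n - 1 : ℕ) : ℝ) = (n : ℝ) - 1 := by
    rw [Nat.cast_sub (by omega), Nat.cast_one]
  have hcu : (#(univ : Finset (Pair n)) : ℝ) = n * ((n : ℝ) - 1) := by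
    rw [card_univ_pair, Nat.cast_mul, hc]
  have hblock := sum_sum_block b fun p => θ p ^ 2
  have hsub : ∀ k i, largest (block b i) k θ ⊆ block b i := fun k i =>
    (isSmallest_largest (block b i) k θ).1
  cases r with
  | greedyBlock P =>
    obtain ⟨h1, h2⟩ := hr
    refine le_div_mul_of_mul_le (by exact_mod_cast h1) ?_
    rw [ruleNormSq, sum_biUnion_of_subset_block b _ fun i _ => hsub P i, sqNorm, ← hblock,
      mul_sum, mul_sum, ← hc]
    exact sum_le_sum fun i _ => mul_sum_sq_le_sum_largest θ h2 (card_block b i).le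
  | random K =>
    obtain ⟨h1, h2⟩ := hr
    refine le_div_mul_of_mul_le (by exact_mod_cast h1) ?_
    rw [ruleNormSq, ← hcu, card_mul_expect_powersetCard_sum (h2.trans card_univ_pair.ge), sqNorm]
  | randomBlock P =>
    obtain ⟨h1, h2⟩ := hr
    refine le_div_mul_of_mul_le (by exact_mod_cast h1) ?_
    rw [ruleNormSq, sqNorm, ← hblock, mul_sum, mul_sum, ← hc]
    refine sum_le_sum fun i _ => ?_
    rw [← card_block b i, card_mul_expect_powersetCard_sum (h2.trans (card_block b i).ge)]
  | randomGreedy M K =>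
    obtain ⟨h1, h2, h3⟩ := hr
    refine le_div_mul_of_mul_le (by exact_mod_cast h1) ?_
    have hM : (0 : ℝ) < M := by exact_mod_cast h1.trans h2
    have e := card_mul_expect_powersetCard_sum (h3.trans card_univ_pair.ge) fun p => θ p ^ 2
    have hle : (K : ℝ) * ((univ : Finset (Pair n)).powersetCard M).expect
          (fun U => ∑ p ∈ U, θ p ^ 2)
        ≤ M * ((univ : Finset (Pair n)).powersetCard M).expect
          (fun U => ∑ p ∈ largest U K θ, θ p ^ 2) := by
      rw [mul_expect, mul_expect]
      exact expect_le_expect fun U hU =>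
        mul_sum_sq_le_sum_largest θ h2 (mem_powersetCard.1 hU).2.le
    rw [ruleNormSq, ← hcu, sqNorm]
    refine le_of_mul_le_mul_left ?_ hM
    have hu : (0 : ℝ) ≤ #(univ : Finset (Pair n)) := Nat.cast_nonneg _
    nlinarith [mul_le_mul_of_nonneg_left hle hu]
  | randomBlockGreedy G P =>
    obtain ⟨h1, h2, h3, h4⟩ := hr
    refine le_div_mul_of_mul_le (by exact_mod_cast Nat.mul_pos h1 h3) ?_
    have e := card_mul_expect_powersetCard_sum (S := (univ : Finset (Fin n)))
      (h2.trans (card_fin n).ge) fun i => ∑ p ∈ block b i, θ p ^ 2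
    rw [card_fin, hblock] at e
    have hle : (P : ℝ) * ((univ : Finset (Fin n)).powersetCard G).expect
          (fun I => ∑ i ∈ I, ∑ p ∈ block b i, θ p ^ 2)
        ≤ (n - 1 : ℕ) * ((univ : Finset (Fin n)).powersetCard G).expect
          (fun I => ∑ p ∈ I.biUnion fun i => largest (block b i) P θ, θ p ^ 2) := by
      rw [mul_expect, mul_expect]
      refine expect_le_expect fun I _ => ?_
      rw [sum_biUnion_of_subset_block b _ fun i _ => hsub P i, mul_sum, mul_sum]
      exact sum_le_sum fun i _ => mul_sum_sq_le_sum_largest θ h4 (card_block b i).le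
    rw [ruleNormSq, sqNorm]
    rw [hc] at hle
    have hn0 : (0 : ℝ) ≤ n := Nat.cast_nonneg _
    nlinarith [mul_le_mul_of_nonneg_left hle hn0]

end Blocks

/-! ### Conditionally uniform samples -/

section Sampling

variable {Ω : Type*} {mΩ : MeasurableSpace Ω} {P : Measure Ω} [IsProbabilityMeasure P]
  {𝒢 : MeasurableSpace Ω} {ι : Type} [DecidableEq ι] [Fintype ι]
  {S : Ω → Finset ι} {k : ℕ} {U : Ω → Finset ι}

lemma integrable_indicator_one {A : Set Ω} (hA : MeasurableSet[mΩ] A) :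
    Integrable (A.indicator fun _ => (1 : ℝ)) P :=
  (integrable_const 1).indicator hA

lemma IsUniformSample.ae_mem (hU : IsUniformSample P 𝒢 S k U) (h𝒢 : 𝒢 ≤ mΩ) :
    ∀ᵐ ω ∂P, U ω ∈ (S ω).powersetCard (min k #(S ω)) := by
  -- On the event that the conditional probability of `U = T` vanishes, `U = T` has probability `0`.
  have key : ∀ T, ∀ᵐ ω ∂P, P[{ω | U ω = T}.indicator (fun _ => (1 : ℝ)) | 𝒢] ω = 0 →
      U ω ≠ T := by
    intro T
    set A := {ω | U ω = T} with hA
    have hAm : MeasurableSet[mΩ] A := hU.1 T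
    set B := {ω | P[A.indicator (fun _ => (1 : ℝ)) | 𝒢] ω = 0} with hB
    have hBm : MeasurableSet[𝒢] B :=
      stronglyMeasurable_condExp.measurable (measurableSet_singleton 0)
    have h1 : ∫ ω in B, A.indicator (fun _ => (1 : ℝ)) ω ∂P = 0 := by
      rw [← setIntegral_condExp h𝒢 (integrable_indicator_one hAm) hBm]
      exact setIntegral_eq_zero_of_forall_eq_zero fun ω hω => hω
    rw [setIntegral_indicator hAm, setIntegral_const, smul_eq_mul, mul_one,
      measureReal_eq_zero_iff] at h1
    rw [measure_eq_zero_iff_ae_notMem] at h1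
    filter_upwards [h1] with ω hω h0 hT
    exact hω ⟨h0, hT⟩
  have hall := ae_all_iff.2 key
  have hlaw := ae_all_iff.2 hU.2
  filter_upwards [hall, hlaw] with ω h1 h2
  by_contra hcon
  refine h1 (U ω) ?_ rfl
  rw [h2 (U ω), if_neg hcon]

/-- The expectation of a history-dependent function of a conditionally uniform sample is the
expectation of its average over the subsets that can be drawn; here in the form of a lower bound
`h` for the average. -/
lemma IsUniformSample.le_integral (hU : IsUniformSample P 𝒢 S k U) (h𝒢 : 𝒢 ≤ mΩ)
    {g : Finset ι → Ω → ℝ} (hgm : ∀ T, StronglyMeasurable[𝒢] (g T))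
    (hgi : ∀ T, Integrable (g T) P) {h : Ω → ℝ} (hh : Integrable h P)
    (hle : ∀ ω, h ω ≤ ((S ω).powersetCard (min k #(S ω))).expect fun T => g T ω) :
    Integrable (fun ω => g (U ω) ω) P ∧ ∫ ω, h ω ∂P ≤ ∫ ω, g (U ω) ω ∂P := by
  set e : Finset ι → Ω → ℝ := fun T => {ω | U ω = T}.indicator (fun _ => (1 : ℝ)) with he
  have hei : ∀ T, Integrable (e T) P := fun T => integrable_indicator_one (hU.1 T)
  have hmul : ∀ T, Integrable (e T * g T) P := by
    intro T
    refine (hgi T).bdd_mul (c := 1) (hei T).aestronglyMeasurable (Filter.Eventually.of_forall ?_)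
    intro ω
    rw [he]
    by_cases hω : U ω = T <;> simp [Set.indicator, hω]
  have hdecomp : (fun ω => g (U ω) ω) = fun ω => ∑ T, (e T * g T) ω := by
    funext ω
    simp [he, Set.indicator]
  have hpull : ∀ T, P[e T * g T | 𝒢] =ᵐ[P] P[e T | 𝒢] * g T := fun T =>
    condExp_mul_of_stronglyMeasurable_right (hgm T) (hmul T) (hei T)
  have hci : ∀ T, Integrable (P[e T | 𝒢] * g T) P := fun T =>
    integrable_condExp.congr (hpull T)
  refine ⟨?_, ?_⟩
  · rw [hdecomp]
    exact integrable_finsetSum _ fun T _ => hmul T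
  have hint : ∫ ω, g (U ω) ω ∂P = ∫ ω, ∑ T, (P[e T | 𝒢] * g T) ω ∂P := by
    rw [hdecomp, integral_finsetSum _ fun T _ => hmul T, integral_finsetSum _ fun T _ => hci T]
    refine sum_congr rfl fun T _ => ?_
    rw [← integral_condExp h𝒢, integral_congr_ae (hpull T)]
  rw [hint]
  refine integral_mono_ae hh (integrable_finsetSum _ fun T _ => hci T) ?_
  filter_upwards [ae_all_iff.2 hU.2] with ω hω
  refine (hle ω).trans (le_of_eq ?_)
  rw [expect_eq_sum_div_card, sum_div]
  simp only [Pi.mul_apply, he, hω, ite_mul, zero_mul]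
  rw [sum_ite_mem, univ_inter]
  exact sum_congr rfl fun T _ => by rw [div_eq_inv_mul]

end Sampling

/-! ### The candidates selected by a rule -/

section Rules

variable {n d : ℕ} (x : Fin n → EuclideanSpace ℝ (Fin d)) {ρ : ℝ} (y : Fin n → ℝ)
  {Ω : Type*} {mΩ : MeasurableSpace Ω} {P : Measure Ω} [IsProbabilityMeasure P]
  {𝒢 : MeasurableSpace Ω}

/-- Let `f` be a nonnegative history-dependent weight that vanishes on the active set and decreases
in the constraint value outside it. In expectation, the selected candidates carry at least the
share `1 / α` of the total weight. As the candidates of a greedy rule need not be measurable,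
their weight is replaced by a lower bound `R` for it. -/
theorem Selects.exists_integrable_le (h𝒢 : 𝒢 ≤ mΩ) (b : BlockKind) {r : Rule} (hr : r.Valid n)
    {W : Ω → Finset (Pair n)} {lam : Ω → Pair n → ℝ} {Δ' : Ω → Finset (Pair n)}
    (hsel : Selects x ρ y b r P 𝒢 W lam Δ') {f : Pair n → Ω → ℝ} (hf0 : ∀ p ω, 0 ≤ f p ω)
    (hfW : ∀ p ω, p ∈ W ω → f p ω = 0)
    (hmono : ∀ ω, ∀ p ∉ W ω, ∀ q ∉ W ω,
      violation x ρ y (lam ω) p ≤ violation x ρ y (lam ω) q → f q ω ≤ f p ω)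
    (hfm : ∀ p, StronglyMeasurable[𝒢] (f p)) (hfi : ∀ p, Integrable (f p) P) :
    ∃ R : Ω → ℝ, Integrable R P ∧ (∀ᵐ ω ∂P, R ω ≤ ∑ p ∈ Δ' ω, f p ω) ∧
      ∫ ω, ∑ p, f p ω ∂P ≤ r.alpha n * ∫ ω, R ω ∂P := by
  have hn := hr.two_le
  have hc : ((n - 1 : ℕ) : ℝ) = (n : ℝ) - 1 := by
    rw [Nat.cast_sub (by omega), Nat.cast_one]
  have hn0 : (0 : ℝ) < n := by
    exact_mod_cast (by omega : 0 < n)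
  have hn1 : (0 : ℝ) < (n - 1 : ℕ) := by
    exact_mod_cast (by omega : 0 < n - 1)
  have hN0 : (0 : ℝ) < (n * (n - 1) : ℕ) := by
    rw [Nat.cast_mul]
    positivity
  have hsdiff : ∀ (A : Finset (Pair n)) ω, ∑ p ∈ A \ W ω, f p ω = ∑ p ∈ A, f p ω := by
    intro A ω
    refine sum_subset sdiff_subset fun p hp hp' => hfW p ω ?_
    by_contra hcon
    exact hp' (mem_sdiff.2 ⟨hp, hcon⟩)
  have hsumm : ∀ A : Finset (Pair n), StronglyMeasurable[𝒢] fun ω => ∑ p ∈ A, f p ω := fun A =>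
    Finset.stronglyMeasurable_fun_sum A fun p _ => hfm p
  have hsumi : ∀ A : Finset (Pair n), Integrable (fun ω => ∑ p ∈ A, f p ω) P := fun A =>
    integrable_finsetSum A fun p _ => hfi p
  have hblock : ∀ ω, ∑ i, ∑ p ∈ block b i, f p ω = ∑ p, f p ω := fun ω =>
    sum_sum_block b fun p => f p ω
  have hcb : ∀ i ω, #(block b i \ W ω) ≤ n - 1 := fun i ω =>
    (card_le_card sdiff_subset).trans (card_block b i).le
  have hcu : ∀ ω, #(univ \ W ω) ≤ n * (n - 1) := fun ω =>
    (card_le_card sdiff_subset).trans card_univ_pair.le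
  have hmono' : ∀ ω (A : Finset (Pair n)), A ⊆ univ \ W ω → ∀ p ∈ A, ∀ q ∈ A,
      violation x ρ y (lam ω) p ≤ violation x ρ y (lam ω) q → f q ω ≤ f p ω :=
    fun ω A hA p hp q hq h =>
      hmono ω p (mem_sdiff.1 (hA hp)).2 q (mem_sdiff.1 (hA hq)).2 h
  cases r with
  | greedyBlock K =>
    obtain ⟨h1, h2⟩ := hr
    have hK : (0 : ℝ) < K := by exact_mod_cast h1
    refine ⟨fun ω => K / (n - 1 : ℕ) * ∑ p, f p ω, (hsumi univ).const_mul _, ?_, ?_⟩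
    · filter_upwards [hsel] with ω hω
      obtain ⟨T, hT, hΔ⟩ := hω
      rw [hΔ, sum_biUnion_of_subset_block b _ fun i _ => (hT i).1.trans sdiff_subset,
        ← hblock, div_mul_eq_mul_div, div_le_iff₀' hn1, mul_sum, mul_sum]
      refine sum_le_sum fun i _ => ?_
      rw [← hsdiff]
      exact (hT i).mul_sum_le (fun p _ => hf0 p ω)
        (hmono' ω _ (sdiff_subset_sdiff (subset_univ _) subset_rfl)) h2 (hcb i ω)
    · rw [Rule.alpha, integral_const_mul, ← hc]
      refine le_of_eq ?_
      field_simp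
  | random K =>
    obtain ⟨h1, h2⟩ := hr
    have hK : (0 : ℝ) < K := by exact_mod_cast h1
    obtain ⟨hi, hle⟩ := IsUniformSample.le_integral hsel h𝒢 (g := fun T ω => ∑ p ∈ T, f p ω)
      hsumm hsumi (h := fun ω => K / (n * (n - 1) : ℕ) * ∑ p, f p ω)
      ((hsumi univ).const_mul _) fun ω => by
        rw [← hsdiff, div_mul_eq_mul_div, div_le_iff₀' hN0]
        exact mul_sum_le_expect_powersetCard_sum (fun p _ => hf0 p ω) h2 (hcu ω)
    refine ⟨_, hi, Filter.Eventually.of_forall fun _ => le_rfl, ?_⟩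
    rw [Rule.alpha, ← hc, ← Nat.cast_mul]
    refine le_div_mul_of_mul_le hK ?_
    rwa [integral_const_mul, div_mul_eq_mul_div, div_le_iff₀' hN0] at hle
  | randomBlock K =>
    obtain ⟨h1, h2⟩ := hr
    have hK : (0 : ℝ) < K := by exact_mod_cast h1
    obtain ⟨U, hU, hΔ⟩ := hsel
    have hs := fun i => IsUniformSample.le_integral (hU i) h𝒢 (g := fun T ω => ∑ p ∈ T, f p ω)
      hsumm hsumi (h := fun ω => K / (n - 1 : ℕ) * ∑ p ∈ block b i, f p ω)
      ((hsumi _).const_mul _) fun ω => by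
        rw [← hsdiff, div_mul_eq_mul_div, div_le_iff₀' hn1]
        exact mul_sum_le_expect_powersetCard_sum (fun p _ => hf0 p ω) h2 (hcb i ω)
    refine ⟨fun ω => ∑ i, ∑ p ∈ U i ω, f p ω, integrable_finsetSum _ fun i _ => (hs i).1, ?_, ?_⟩
    · filter_upwards [hΔ, ae_all_iff.2 fun i => (hU i).ae_mem h𝒢] with ω hω hmem
      rw [hω, sum_biUnion_of_subset_block b _ fun i _ =>
        (mem_powersetCard.1 (hmem i)).1.trans sdiff_subset]
    · rw [Rule.alpha, ← hc]
      refine le_div_mul_of_mul_le hK ?_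
      simp only [← hblock]
      rw [integral_finsetSum _ fun i _ => (hs i).1, integral_finsetSum _ fun i _ => hsumi _,
        mul_sum, mul_sum]
      refine sum_le_sum fun i _ => ?_
      have := (hs i).2
      rwa [integral_const_mul, div_mul_eq_mul_div, div_le_iff₀' hn1] at this
  | randomGreedy M K =>
    obtain ⟨h1, h2, h3⟩ := hr
    have hK : (0 : ℝ) < K := by exact_mod_cast h1
    have hM : (0 : ℝ) < M := by exact_mod_cast h1.trans h2
    obtain ⟨U, hU, hΔ⟩ := hsel
    obtain ⟨hi, hle⟩ := IsUniformSample.le_integral hU h𝒢 (g := fun T ω => ∑ p ∈ T, f p ω)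
      hsumm hsumi (h := fun ω => M / (n * (n - 1) : ℕ) * ∑ p, f p ω)
      ((hsumi univ).const_mul _) fun ω => by
        rw [← hsdiff, div_mul_eq_mul_div, div_le_iff₀' hN0]
        exact mul_sum_le_expect_powersetCard_sum (fun p _ => hf0 p ω) h3 (hcu ω)
    refine ⟨fun ω => K / M * ∑ p ∈ U ω, f p ω, hi.const_mul _, ?_, ?_⟩
    · filter_upwards [hΔ, hU.ae_mem h𝒢] with ω hω hmem
      obtain ⟨hsub, hcard⟩ := mem_powersetCard.1 hmem
      rw [div_mul_eq_mul_div, div_le_iff₀' hM]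
      exact hω.mul_sum_le (fun p _ => hf0 p ω) (hmono' ω _ hsub) h2
        (hcard.trans_le (min_le_left _ _))
    · rw [Rule.alpha, ← hc, ← Nat.cast_mul]
      refine le_div_mul_of_mul_le hK ?_
      rw [integral_const_mul, div_mul_eq_mul_div, div_le_iff₀' hN0] at hle
      rw [integral_const_mul, ← mul_assoc, mul_div_assoc', div_mul_eq_mul_div, le_div_iff₀ hM]
      nlinarith
  | randomBlockGreedy G K =>
    obtain ⟨h1, h2, h3, h4⟩ := hr
    have hG : (0 : ℝ) < G := by exact_mod_cast h1
    have hK : (0 : ℝ) < K := by exact_mod_cast h3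
    obtain ⟨I, hI, hΔ⟩ := hsel
    obtain ⟨hi, hle⟩ := IsUniformSample.le_integral hI h𝒢
      (g := fun T ω => ∑ i ∈ T, ∑ p ∈ block b i, f p ω)
      (fun T => Finset.stronglyMeasurable_fun_sum T fun i _ => hsumm _)
      (fun T => integrable_finsetSum T fun i _ => hsumi _)
      (h := fun ω => G / n * ∑ p, f p ω)
      ((hsumi univ).const_mul _) fun ω => by
        rw [← hblock, div_mul_eq_mul_div, div_le_iff₀' hn0]
        exact mul_sum_le_expect_powersetCard_sum
          (fun i _ => sum_nonneg fun p _ => hf0 p ω) h2 (card_fin n).le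
    refine ⟨fun ω => K / (n - 1 : ℕ) * ∑ i ∈ I ω, ∑ p ∈ block b i, f p ω, hi.const_mul _, ?_, ?_⟩
    · filter_upwards [hΔ] with ω hω
      obtain ⟨T, hT, hΔω⟩ := hω
      rw [hΔω, sum_biUnion_of_subset_block b _ fun i hi => (hT i hi).1.trans sdiff_subset,
        div_mul_eq_mul_div, div_le_iff₀' hn1, mul_sum, mul_sum]
      refine sum_le_sum fun i hi => ?_
      rw [← hsdiff]
      exact (hT i hi).mul_sum_le (fun p _ => hf0 p ω)
        (hmono' ω _ (sdiff_subset_sdiff (subset_univ _) subset_rfl)) h4 (hcb i ω)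
    · rw [integral_const_mul, div_mul_eq_mul_div, div_le_iff₀' hn0] at hle
      rw [Rule.alpha, ← hc]
      refine le_div_mul_of_mul_le (mul_pos hG hK) ?_
      rw [integral_const_mul]
      have e : (n : ℝ) * (n - 1 : ℕ) * (K / (n - 1 : ℕ) *
          ∫ ω, ∑ i ∈ I ω, ∑ p ∈ block b i, f p ω ∂P)
          = K * (n * ∫ ω, ∑ i ∈ I ω, ∑ p ∈ block b i, f p ω ∂P) := by
        field_simp
      rw [e]
      nlinarith

end Rules

/-! ### The runs of the algorithm -/

section Runs

variable {n d : ℕ} {x : Fin n → EuclideanSpace ℝ (Fin d)} {ρ : ℝ} {y : Fin n → ℝ}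
  {mode : Mode} {b : BlockKind} {r : Rule} {W0 : Finset (Pair n)} {lam0 : Pair n → ℝ}
  {Ω : Type*} {mΩ : MeasurableSpace Ω} {P : Measure Ω} {ℱ : Filtration ℕ mΩ}
  {W : ℕ → Ω → Finset (Pair n)} {lam : ℕ → Ω → Pair n → ℝ}

lemma ReducedFeasible.mono {W₁ W₂ : Finset (Pair n)} {z : Pair n → ℝ}
    (hz : ReducedFeasible W₁ z) (h : W₁ ⊆ W₂) : ReducedFeasible W₂ z :=
  ⟨hz.1, fun p hp => hz.2 p fun hp' => hp (h hp')⟩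

lemma IsRun.ae_subset (hrun : IsRun x ρ y mode b r W0 lam0 P ℱ W lam) (m : ℕ) :
    ∀ᵐ ω ∂P, W m ω ⊆ W (m + 1) ω := by
  obtain ⟨Δ', -, hΔ⟩ := hrun.augment m
  filter_upwards [hΔ] with ω hω
  rw [hω]
  exact subset_union_left

/-- The iterates are feasible, and the objective never exceeds its initial value. -/
lemma IsRun.ae_feasible (hrun : IsRun x ρ y mode b r W0 lam0 P ℱ W lam) (hρ : 0 < ρ)
    (hσ : 0 < smoothness x ρ) (h0 : ReducedFeasible W0 lam0) (m : ℕ) :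
    ∀ᵐ ω ∂P, ReducedFeasible (W m ω) (lam m ω) ∧
      dualObj x ρ y (lam m ω) ≤ dualObj x ρ y lam0 := by
  induction m with
  | zero =>
    filter_upwards [hrun.init_W, hrun.init_lam] with ω hW hlam
    rw [hW]
    rcases hlam with h | h
    · rw [h]
      exact ⟨h0, le_rfl⟩
    · exact ⟨solveReduced_feasible x y h, dualObj_le_dualObj_of_solveReduced x y hρ hσ h0 h⟩
  | succ m ih =>
    filter_upwards [ih, hrun.ae_subset m, hrun.solve m] with ω h hsub hs
    exact ⟨solveReduced_feasible x y hs,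
      (dualObj_le_dualObj_of_solveReduced x y hρ hσ (h.1.mono hsub) hs).trans h.2⟩

lemma IsRun.integrable_dualObj [IsProbabilityMeasure P]
    (hrun : IsRun x ρ y mode b r W0 lam0 P ℱ W lam) (hρ : 0 < ρ)
    (hσ : 0 < smoothness x ρ) (h0 : ReducedFeasible W0 lam0) (m : ℕ) :
    Integrable (fun ω => dualObj x ρ y (lam m ω)) P := by
  have hm : Measurable fun ω => dualObj x ρ y (lam m ω) :=
    (continuous_dualObj x y hρ).measurable.comp ((hrun.measurable_lam m).mono (ℱ.le m) le_rfl)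
  refine Integrable.of_mem_Icc (-(1 / 2 * sqNorm y)) (dualObj x ρ y lam0) hm.aemeasurable ?_
  filter_upwards [hrun.ae_feasible hρ hσ h0 m] with ω hω
  exact ⟨neg_sqNorm_le_dualObj x y hρ _, hω.2⟩

/-- The decrease predicted by the model at the entry `p`, if `p` is not in the active set. -/
noncomputable def inactiveDecrease (x : Fin n → EuclideanSpace ℝ (Fin d)) (ρ : ℝ) (y : Fin n → ℝ)
    (W : Finset (Pair n)) (lam : Pair n → ℝ) (p : Pair n) : ℝ :=
  if p ∈ W then 0 else max (dualGrad x ρ y lam p) 0 ^ 2 / (2 * smoothness x ρ)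

lemma inactiveDecrease_of_mem {V : Finset (Pair n)} {z : Pair n → ℝ} {p : Pair n} (hp : p ∈ V) :
    inactiveDecrease x ρ y V z p = 0 := if_pos hp

lemma inactiveDecrease_eq_modelDecrease (hσ : 0 < smoothness x ρ) {V : Finset (Pair n)}
    {z : Pair n → ℝ} (hz : ReducedFeasible V z) {p : Pair n} (hp : p ∉ V) :
    inactiveDecrease x ρ y V z p
      = modelDecrease (smoothness x ρ) (dualGrad x ρ y z p) (z p) := by
  rw [hz.2 p hp, modelDecrease_zero hσ, inactiveDecrease, if_neg hp]

lemma inactiveDecrease_nonneg (hσ : 0 < smoothness x ρ) (V : Finset (Pair n)) (z : Pair n → ℝ)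
    (p : Pair n) : 0 ≤ inactiveDecrease x ρ y V z p := by
  rw [inactiveDecrease]
  split_ifs
  · exact le_rfl
  · positivity

lemma inactiveDecrease_anti (hσ : 0 < smoothness x ρ) {V : Finset (Pair n)} {z : Pair n → ℝ}
    {p q : Pair n} (hp : p ∉ V) (hq : q ∉ V) (h : violation x ρ y z p ≤ violation x ρ y z q) :
    inactiveDecrease x ρ y V z q ≤ inactiveDecrease x ρ y V z p := by
  rw [violation_eq_neg_dualGrad, Pi.neg_apply, Pi.neg_apply, neg_le_neg_iff] at h
  rw [inactiveDecrease, inactiveDecrease, if_neg hp, if_neg hq]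
  have : max (dualGrad x ρ y z q) 0 ≤ max (dualGrad x ρ y z p) 0 := max_le_max_right 0 h
  gcongr

lemma sum_modelDecrease_eq (hσ : 0 < smoothness x ρ) {V : Finset (Pair n)} {z : Pair n → ℝ}
    (hz : ReducedFeasible V z) :
    ∑ p, modelDecrease (smoothness x ρ) (dualGrad x ρ y z p) (z p)
      = ∑ p ∈ V, modelDecrease (smoothness x ρ) (dualGrad x ρ y z p) (z p)
        + ∑ p, inactiveDecrease x ρ y V z p := by
  rw [← sum_sdiff (subset_univ V), add_comm]
  congr 1
  rw [← sum_subset (sdiff_subset (s := univ) (t := V)) fun p _ hp =>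
    inactiveDecrease_of_mem (by simpa using hp)]
  exact sum_congr rfl fun p hp =>
    (inactiveDecrease_eq_modelDecrease hσ hz (mem_sdiff.1 hp).2).symm

lemma inactiveDecrease_le (hρ : 0 < ρ) (hσ : 0 < smoothness x ρ) {V : Finset (Pair n)}
    {z : Pair n → ℝ} (hz : ReducedFeasible V z) (p : Pair n) :
    inactiveDecrease x ρ y V z p ≤ dualObj x ρ y z + 1 / 2 * sqNorm y := by
  have hstep := dualObj_proxStep_le x y hρ (hz.mono (subset_univ V)) hσ
    (mul_inv_cancel₀ hσ.ne').ge (by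
      rw [inv_mul_le_iff₀ hσ]
      exact sqNorm_matD_mulVec_le x hρ _)
  have hlow := neg_sqNorm_le_dualObj x y hρ (proxStep x ρ y univ (smoothness x ρ)⁻¹ z)
  have h1 : inactiveDecrease x ρ y V z p ≤ ∑ q, inactiveDecrease x ρ y V z q :=
    single_le_sum (f := inactiveDecrease x ρ y V z)
      (fun q _ => inactiveDecrease_nonneg hσ V z q) (mem_univ p)
  have h2 : 0 ≤ ∑ q ∈ V, modelDecrease (smoothness x ρ) (dualGrad x ρ y z q) (z q) :=
    sum_nonneg fun q _ => modelDecrease_nonneg hσ (hz.1 q)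
  rw [sum_modelDecrease_eq hσ hz] at hstep
  linarith

/-- Augmenting the active set by the violated candidates collects the predicted decrease of all
candidates, since a candidate that is not violated has none. -/
lemma sum_inactiveDecrease_le_of_augment (hσ : 0 < smoothness x ρ) {V V' C : Finset (Pair n)}
    {z : Pair n → ℝ} (hz : ReducedFeasible V z)
    (hV' : V' = V ∪ C.filter fun p => violation x ρ y z p < 0) :
    ∑ p ∈ V, modelDecrease (smoothness x ρ) (dualGrad x ρ y z p) (z p)
        + ∑ p ∈ C, inactiveDecrease x ρ y V z p
      ≤ ∑ p ∈ V', modelDecrease (smoothness x ρ) (dualGrad x ρ y z p) (z p) := by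
  have hsub : V ⊆ V' := hV' ▸ subset_union_left
  rw [← sum_sdiff hsub, add_comm]
  refine add_le_add_left ?_ _
  have h1 : ∑ p ∈ V' \ V, inactiveDecrease x ρ y V z p
      = ∑ p ∈ V' \ V, modelDecrease (smoothness x ρ) (dualGrad x ρ y z p) (z p) :=
    sum_congr rfl fun p hp => inactiveDecrease_eq_modelDecrease hσ hz (mem_sdiff.1 hp).2
  have h2 : ∑ p ∈ V' \ V, inactiveDecrease x ρ y V z p
      = ∑ p ∈ C ∪ V' \ V, inactiveDecrease x ρ y V z p := by
    refine sum_subset subset_union_right fun p hp hp' => ?_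
    have hpC : p ∈ C := (mem_union.1 hp).resolve_right hp'
    by_cases hpV : p ∈ V
    · exact inactiveDecrease_of_mem hpV
    have hviol : ¬ violation x ρ y z p < 0 := fun h => hp' (mem_sdiff.2
      ⟨hV' ▸ mem_union_right _ (mem_filter.2 ⟨hpC, h⟩), hpV⟩)
    rw [violation_eq_neg_dualGrad, Pi.neg_apply, neg_neg_iff_pos, not_lt] at hviol
    rw [inactiveDecrease, if_neg hpV, max_eq_right hviol]
    simp
  rw [← h1, h2]
  exact sum_le_sum_of_subset_of_nonneg subset_union_left fun p _ _ =>
    inactiveDecrease_nonneg hσ V z p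

lemma IsRun.measurable_inactiveDecrease (hrun : IsRun x ρ y mode b r W0 lam0 P ℱ W lam)
    (m : ℕ) (p : Pair n) :
    Measurable[ℱ m] fun ω => inactiveDecrease x ρ y (W m ω) (lam m ω) p := by
  have hset : MeasurableSet[ℱ m] {ω | p ∈ W m ω} := by
    have : {ω | p ∈ W m ω} = ⋃ T : Finset (Pair n), ⋃ _ : p ∈ T, {ω | W m ω = T} := by
      ext ω
      simp
    rw [this]
    exact MeasurableSet.iUnion fun T => MeasurableSet.iUnion fun _ => hrun.measurable_W m T
  have hg : Measurable fun z : Pair n → ℝ =>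
      max (dualGrad x ρ y z p) 0 ^ 2 / (2 * smoothness x ρ) := by
    have := ((continuous_apply p).comp (continuous_dualGrad x (ρ := ρ) y)).measurable
    exact ((this.max measurable_const).pow_const 2).div_const _
  exact Measurable.ite hset measurable_const (hg.comp (hrun.measurable_lam m))

/-- The expected contraction of the optimality gap in one iteration. -/
theorem IsRun.integral_gap_succ_le [IsProbabilityMeasure P]
    (hrun : IsRun x ρ y mode b r W0 lam0 P ℱ W lam) (hρ : 0 < ρ)
    (hσ : 0 < smoothness x ρ) (h0 : ReducedFeasible W0 lam0) (hr : r.Valid n) {μ : ℝ}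
    (hμ : IsHoffmanConstant (matD x ρ) μ) (hμσ : μ ≤ smoothness x ρ) (m : ℕ) :
    ∫ ω, (dualObj x ρ y (lam (m + 1) ω) - dualOpt x ρ y) ∂P
      ≤ (1 - μ / (smoothness x ρ * r.alpha n)) *
        ∫ ω, (dualObj x ρ y (lam m ω) - dualOpt x ρ y) ∂P := by
  set σ := smoothness x ρ
  set α := r.alpha n
  have hα1 : 1 ≤ α := hr.one_le_alpha
  have hα : 0 < α := one_pos.trans_le hα1
  set f : Pair n → Ω → ℝ := fun p ω => inactiveDecrease x ρ y (W m ω) (lam m ω) p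
  have hfeas := hrun.ae_feasible hρ hσ h0 m
  have hfm : ∀ p, Measurable[ℱ m] (f p) := fun p => hrun.measurable_inactiveDecrease m p
  have hfi : ∀ p, Integrable (f p) P := by
    intro p
    refine Integrable.of_mem_Icc 0 (dualObj x ρ y lam0 + 1 / 2 * sqNorm y)
      ((hfm p).mono (ℱ.le m) le_rfl).aemeasurable ?_
    filter_upwards [hfeas] with ω hω
    have := inactiveDecrease_le (y := y) hρ hσ hω.1 p
    exact ⟨inactiveDecrease_nonneg hσ _ _ p, by linarith [hω.2]⟩
  obtain ⟨Δ', hsel, hΔ⟩ := hrun.augment m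
  obtain ⟨R, hRi, hRle, hR⟩ := hsel.exists_integrable_le x y (ℱ.le m) b hr (f := f)
    (fun p ω => inactiveDecrease_nonneg hσ _ _ p) (fun p ω hp => inactiveDecrease_of_mem hp)
    (fun ω p hp q hq h => inactiveDecrease_anti hσ hp hq h)
    (fun p => (hfm p).stronglyMeasurable) hfi
  have hLi := hrun.integrable_dualObj hρ hσ h0
  have hgap : ∀ k, Integrable (fun ω => dualObj x ρ y (lam k ω) - dualOpt x ρ y) P := fun k =>
    (hLi k).sub (integrable_const _)
  have hfs : Integrable (fun ω => ∑ p, f p ω) P := integrable_finsetSum _ fun p _ => hfi p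
  have hsumi : Integrable (fun ω => (1 - μ / (σ * α)) *
      (dualObj x ρ y (lam m ω) - dualOpt x ρ y) + 1 / α * ∑ p, f p ω) P :=
    ((hgap m).const_mul _).add (hfs.const_mul _)
  have hpt : ∀ᵐ ω ∂P, dualObj x ρ y (lam (m + 1) ω) - dualOpt x ρ y
      ≤ (1 - μ / (σ * α)) * (dualObj x ρ y (lam m ω) - dualOpt x ρ y)
        + 1 / α * ∑ p, f p ω - R ω := by
    filter_upwards [hfeas, hrun.ae_subset m, hrun.solve m, hΔ, hRle] with ω hω hsub hs hWω hRω
    have hdec := dualObj_le_of_solveReduced x y hρ hσ (hω.1.mono hsub) hs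
    have haug := sum_inactiveDecrease_le_of_augment hσ hω.1 hWω
    have hsum := sum_modelDecrease_eq (y := y) hσ hω.1
    have hPL : μ / σ * (dualObj x ρ y (lam m ω) - dualOpt x ρ y)
        ≤ ∑ p, modelDecrease σ (dualGrad x ρ y (lam m ω) p) (lam m ω p) := by
      have hμσ0 : 0 < μ / σ := div_pos hμ.1 hσ
      rw [← le_div_iff₀' hμσ0, sub_le_comm]
      refine le_dualOpt x y fun z hz => ?_
      rw [sub_le_comm, le_div_iff₀' hμσ0]
      exact mul_sub_le_sum_modelDecrease x y hρ hμ hσ hμσ hω.1.1 hz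
    have hact : 0 ≤ ∑ p ∈ W m ω, modelDecrease σ (dualGrad x ρ y (lam m ω) p) (lam m ω p) :=
      sum_nonneg fun p _ => modelDecrease_nonneg hσ (hω.1.1 p)
    -- As `1 ≤ α`, only the share `1 / α` of the decrease on the active set is needed.
    have hshare : 1 / α * ∑ p ∈ W m ω, modelDecrease σ (dualGrad x ρ y (lam m ω) p) (lam m ω p)
        ≤ ∑ p ∈ W m ω, modelDecrease σ (dualGrad x ρ y (lam m ω) p) (lam m ω p) :=
      mul_le_of_le_one_left hact ((div_le_one hα).2 hα1)
    have hPL' := mul_le_mul_of_nonneg_left hPL (one_div_pos.2 hα).le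
    rw [hsum, mul_add, ← mul_assoc, one_div_mul_eq_div, div_div] at hPL'
    change R ω ≤ ∑ p ∈ Δ' ω, inactiveDecrease x ρ y (W m ω) (lam m ω) p at hRω
    change _ ≤ _ + 1 / α * ∑ p, inactiveDecrease x ρ y (W m ω) (lam m ω) p - R ω
    linarith
  have hint := integral_mono_ae (hgap (m + 1)) (hsumi.sub hRi) hpt
  refine hint.trans ?_
  have e : ∫ ω, ((1 - μ / (σ * α)) * (dualObj x ρ y (lam m ω) - dualOpt x ρ y)
        + 1 / α * ∑ p, f p ω - R ω) ∂P
      = (1 - μ / (σ * α)) * ∫ ω, (dualObj x ρ y (lam m ω) - dualOpt x ρ y) ∂P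
        + 1 / α * ∫ ω, ∑ p, f p ω ∂P - ∫ ω, R ω ∂P := by
    rw [integral_sub hsumi hRi,
      integral_add ((hgap m).const_mul _) (hfs.const_mul _), integral_const_mul,
      integral_const_mul]
  have hfR : 1 / α * ∫ ω, ∑ p, f p ω ∂P ≤ ∫ ω, R ω ∂P := by
    rwa [one_div_mul_eq_div, div_le_iff₀' hα]
  exact e.trans_le (by linarith)

end Runs

end ConvexRegression

theorem theorem1 {n d : ℕ} (x : Fin n → EuclideanSpace ℝ (Fin d)) (ρ : ℝ) (hρ : 0 < ρ) :
    (∃ μ : ℝ, ConvexRegression.IsHoffmanConstant (ConvexRegression.matD x ρ) μ) ∧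
    ∀ μ : ℝ, ConvexRegression.IsHoffmanConstant (ConvexRegression.matD x ρ) μ →
    ∀ (b : ConvexRegression.BlockKind) (r : ConvexRegression.Rule), r.Valid n →
      (∀ θ : ConvexRegression.Pair n → ℝ,
        ConvexRegression.sqNorm θ ≤ r.alpha n * ConvexRegression.ruleNormSq b r θ) ∧
      0 ≤ 1 - μ / (ConvexRegression.smoothness x ρ * r.alpha n) ∧
      1 - μ / (ConvexRegression.smoothness x ρ * r.alpha n) < 1 ∧
      ∀ (y : Fin n → ℝ) (mode : ConvexRegression.Mode)
        (W0 : Finset (ConvexRegression.Pair n)) (lam0 : ConvexRegression.Pair n → ℝ),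
        ConvexRegression.ReducedFeasible W0 lam0 →
        ∀ {Ω : Type*} {mΩ : MeasurableSpace Ω} (P : MeasureTheory.Measure Ω)
          [MeasureTheory.IsProbabilityMeasure P] (ℱ : MeasureTheory.Filtration ℕ mΩ)
          (W : ℕ → Ω → Finset (ConvexRegression.Pair n))
          (lam : ℕ → Ω → ConvexRegression.Pair n → ℝ),
          ConvexRegression.IsRun x ρ y mode b r W0 lam0 P ℱ W lam →
          ∀ m : ℕ,
            MeasureTheory.Integrable (fun ω => ConvexRegression.dualObj x ρ y (lam m ω)) P ∧
            ∫ ω, (ConvexRegression.dualObj x ρ y (lam m ω)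
                - ConvexRegression.dualOpt x ρ y) ∂P ≤
              (1 - μ / (ConvexRegression.smoothness x ρ * r.alpha n)) ^ m *
                (ConvexRegression.dualObj x ρ y lam0 - ConvexRegression.dualOpt x ρ y) := by
  refine ⟨ConvexRegression.exists_isHoffmanConstant _, fun μ hμ b r hr => ?_⟩
  have hn := hr.two_le
  -- A valid rule needs two points, so that there is an index at which to compare `μ` with `σ`.
  have p : ConvexRegression.Pair n :=
    ⟨(⟨0, by omega⟩, ⟨1, by omega⟩), by simp⟩
  have hμσ := ConvexRegression.hoffman_le_smoothness x hρ hμ p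
  have hσ : 0 < ConvexRegression.smoothness x ρ := hμ.1.trans_le hμσ
  have hα1 := hr.one_le_alpha
  have hα : 0 < r.alpha n := one_pos.trans_le hα1
  have hrate : 0 ≤ 1 - μ / (ConvexRegression.smoothness x ρ * r.alpha n) := by
    rw [sub_nonneg, div_le_one (mul_pos hσ hα)]
    exact hμσ.trans (le_mul_of_one_le_right hσ.le hα1)
  refine ⟨ConvexRegression.sqNorm_le_alpha_mul_ruleNormSq b hr, hrate,
    sub_lt_self 1 (div_pos hμ.1 (mul_pos hσ hα)), ?_⟩
  intro y mode W0 lam0 h0 Ω mΩ P _ ℱ W lam hrun m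
  refine ⟨hrun.integrable_dualObj hρ hσ h0 m, ?_⟩
  induction m with
  | zero =>
    rw [pow_zero, one_mul]
    have hle := integral_mono_ae
      ((hrun.integrable_dualObj hρ hσ h0 0).sub (integrable_const _)) (integrable_const
        (ConvexRegression.dualObj x ρ y lam0 - ConvexRegression.dualOpt x ρ y))
      ((hrun.ae_feasible hρ hσ h0 0).mono fun ω hω => sub_le_sub_right hω.2 _)
    simpa using hle
  | succ m ih =>
    refine (hrun.integral_gap_succ_le hρ hσ h0 hr hμ hμσ m).trans ?_
    rw [pow_succ', mul_assoc]
    exact mul_le_mul_of_nonneg_left ih hrate
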